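/- **Theorem 2** ($\pi_1(BQ\mathcal C)\cong K_0$). Let $\mathcal C$ be a small category which is pointed (it has a zero object) and balanced (every morphism that is both mono and epi is an isomorphism). Call a sequence $X\xrightarrow{i}Y\xrightarrow{j}Z$ in $\mathcal C$ *strong exact* if $i$ is a kernel of $j$ and $j$ is a cokernel of $i$. Let $\mathcal E$ be a class of strong exact sequences, closed under isomorphism. Call $i$ an $\mathcal E$-kernel and $j$ an $\mathcal E$-cokernel if $X\xrightarrow{i}Y\xrightarrow{j}Z$ is in $\mathcal E$. Suppose that $(\mathcal C,\mathcal E)$ is a quasi-exact category, that is: * any two objects $X,Y$ have a coproduct $X\oplus Y$, and the natural sequence $X\to X\oplus Y\to Y$ (the inclusion, followed by the map which is $0$ on $X$ and the identity on $Y$) belongs to $\mathcal E$; * the class of $\mathcal E$-kernels is closed under composition and under base change by $\mathcal E$-cokernels, and the class of $\mathcal E$-cokernels is closed under composition and under base change by $\mathcal E$-kernels. Let $Q\mathcal C$ be the category with the objects of $\mathcal C$, in which a morphism from $X$ to $Y$ is an isomorphism class of diagrams $X\xleftarrow{j}S\xrightarrow{i}Y$ with $i$ an $\mathcal E$-kernel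 and $j$ an $\mathcal E$-cokernel, and in which the composite of $X\leftarrow S\to Y$ and $Y\leftarrow T\to Z$ is $X\leftarrow S\times_Y T\to Z$. An $\mathcal E$-kernel $i:X\to Y$ gives a morphism $i_!:X\to Y$ of $Q\mathcal C$ (take $S=X$, $j=\mathrm{id}$), and an $\mathcal E$-cokernel $j:Y\to X$ gives a morphism $j^!:X\to Y$ of $Q\mathcal C$ (take $S=Y$, $i=\mathrm{id}$). Let $BQ\mathcal C$ be the classifying space of $Q\mathcal C$, i.e. the geometric realization of its nerve. Let $K_0(\mathcal C,\mathcal E)$ be the abelian group with one generator $[X]$ for each object $X$ of $\mathcal C$ and one relation $[Y]=[X]+[Z]$ for each sequence $X\to Y\to Z$ in $\mathcal E$. Then for every zero object $0$ of $\mathcal C$ the fundamental group $\pi_1(BQ\mathcal C,0)$ is canonically isomorphic to $K_0(\mathcal C,\mathcal E)$: there is an isomorphism $K_0(\mathcal C,\mathcal E)\to\pi_1(BQ\mathcal C,0)$ which sends $[X]$, for every object $X$, to the class of the loop that runs from $0$ to $X$ along the edge $j_X^!$ and back to $0$ along the edge $i_{X!}$, where $j_X:X\to 0$ and $i_X:0\to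 X$ are the unique morphisms of $\mathcal C$. -/

import Mathlib

open CategoryTheory CategoryTheory.Limits Opposite Simplicial

universe v u

namespace QuasiExact

section StrongExact

variable {C : Type u} [Category.{v} C] [HasZeroMorphisms C]

/-- A sequence `0 ⟶ X ⟶ Y ⟶ Z ⟶ 0` in a pointed category, with maps `i : X ⟶ Y` and
`j : Y ⟶ Z`, is strong exact if `i` is the kernel of `j` and `j` is the cokernel of `i`. -/
def IsStrongExact (S : ShortComplex C) : Prop :=
  Nonempty (IsLimit (KernelFork.ofι S.f S.zero)) ∧
    Nonempty (IsColimit (CokernelCofork.ofπ S.g S.zero))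

/-- The natural sequence `X ⟶ X ⊕ Y ⟶ Y`, where `X ⊕ Y` is the coproduct: the first map is the
inclusion, and the second one is zero on `X` and the identity on `Y`. -/
noncomputable def sumSequence (X Y : C) [HasBinaryCoproduct X Y] : ShortComplex C :=
  ShortComplex.mk (coprod.inl : X ⟶ X ⨿ Y) (coprod.desc (0 : X ⟶ Y) (𝟙 Y)) (coprod.inl_desc _ _)

/-- `i` is the kernel map of a sequence which belongs to the class `E`. -/
def IsKernelIn (E : ObjectProperty (ShortComplex C)) : MorphismProperty C :=
  fun _ Y i => ∃ (Z : C) (j : Y ⟶ Z) (w : i ≫ j = 0), E (ShortComplex.mk i j w)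

/-- `j` is the cokernel map of a sequence which belongs to the class `E`. -/
def IsCokernelIn (E : ObjectProperty (ShortComplex C)) : MorphismProperty C :=
  fun Y _ j => ∃ (X : C) (i : X ⟶ Y) (w : i ≫ j = 0), E (ShortComplex.mk i j w)

end StrongExact

/-- The structure of a quasi-exact category on a category `C` with zero morphisms: `C` is pointed
and balanced, and there is a class of strong exact sequences, closed under isomorphism, which
contains the natural sequences `X ⟶ X ⊕ Y ⟶ Y`, and such that its kernels are closed under
composition and under base change by its cokernels, and its cokernels are closed under composition
and under base change by its kernels. -/
structure QuasiExactStructure (C : Type u) [Category.{v} C] [HasZeroMorphisms C] where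
  hasZeroObject : HasZeroObject C
  balanced : Balanced C
  /-- the distinguished class of sequences -/
  E : ObjectProperty (ShortComplex C)
  strongExact : ∀ S, E S → IsStrongExact S
  closed : ∀ S T : ShortComplex C, Nonempty (S ≅ T) → E S → E T
  hasBinaryCoproduct : ∀ X Y : C, HasBinaryCoproduct X Y
  sum_mem : ∀ X Y : C, E (sumSequence X Y)
  kernel_comp : ∀ {X Y Z : C} (f : X ⟶ Y) (g : Y ⟶ Z),
    IsKernelIn E f → IsKernelIn E g → IsKernelIn E (f ≫ g)
  cokernel_comp : ∀ {X Y Z : C} (f : X ⟶ Y) (g : Y ⟶ Z),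
    IsCokernelIn E f → IsCokernelIn E g → IsCokernelIn E (f ≫ g)
  kernel_baseChange : ∀ {P S T Y : C} {p : P ⟶ S} {q : P ⟶ T} {i : S ⟶ Y} {j : T ⟶ Y},
    IsPullback p q i j → IsKernelIn E i → IsCokernelIn E j → IsKernelIn E q
  cokernel_baseChange : ∀ {P S T Y : C} {p : P ⟶ S} {q : P ⟶ T} {i : S ⟶ Y} {j : T ⟶ Y},
    IsPullback p q i j → IsKernelIn E i → IsCokernelIn E j → IsCokernelIn E p

namespace QuasiExactStructure

variable {C : Type u} [Category.{v} C] [HasZeroMorphisms C] (A : QuasiExactStructure C)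

/-- The `E`-kernels. -/
abbrev IsKer : MorphismProperty C := IsKernelIn A.E

/-- The `E`-cokernels. -/
abbrev IsCoker : MorphismProperty C := IsCokernelIn A.E

section Basic

variable {A}

/-- The base change of an `E`-kernel by an `E`-cokernel exists. -/
lemma hasPullback {S T Y : C} {i : S ⟶ Y} {j : T ⟶ Y} (hi : A.IsKer i) (hj : A.IsCoker j) :
    HasPullback i j := by
  obtain ⟨Z, p, w, hE⟩ := hi
  obtain ⟨⟨hl⟩, -⟩ := A.strongExact _ hE
  obtain ⟨K, k, wk, hk⟩ := A.cokernel_comp j p hj ⟨_, i, w, hE⟩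
  obtain ⟨⟨hkl⟩, -⟩ := A.strongExact _ hk
  dsimp at hl hkl
  have wk' : (k ≫ j) ≫ p = 0 := by simpa using wk
  obtain ⟨l, hlk⟩ := KernelFork.IsLimit.lift' hl (k ≫ j) wk'
  dsimp at hlk
  have hmi : ∀ {W : C} (a b : W ⟶ S), a ≫ i = b ≫ i → a = b :=
    fun a b h => Fork.IsLimit.hom_ext hl h
  have hmk : ∀ {W : C} (a b : W ⟶ K), a ≫ k = b ≫ k → a = b :=
    fun a b h => Fork.IsLimit.hom_ext hkl h
  have hs : ∀ s : PullbackCone i j, s.snd ≫ j ≫ p = 0 := fun s => by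
    rw [← Category.assoc, ← s.condition, Category.assoc, w, comp_zero]
  choose r hr using fun s : PullbackCone i j =>
    (⟨_, (KernelFork.IsLimit.lift' hkl s.snd (hs s)).2⟩ : ∃ r : s.pt ⟶ K, r ≫ k = s.snd)
  refine ⟨⟨⟨PullbackCone.mk l k hlk, PullbackCone.IsLimit.mk _ r ?_ hr ?_⟩⟩⟩
  · intro s
    apply hmi
    rw [Category.assoc, hlk, s.condition, ← Category.assoc, hr]
  · intro s m _ h2
    exact hmk _ _ (h2.trans (hr s).symm)

lemma isKer_iso_comp {X X' Y : C} (e : X ≅ X') {i : X' ⟶ Y} (hi : A.IsKer i) :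
    A.IsKer (e.hom ≫ i) := by
  obtain ⟨Z, p, w, hE⟩ := hi
  refine ⟨Z, p, by simp [w], A.closed _ _ ⟨?_⟩ hE⟩
  exact ShortComplex.isoMk e.symm (Iso.refl _) (Iso.refl _) (by simp) (by simp)

lemma isCoker_iso_comp {X X' Y : C} (e : X ≅ X') {j : X' ⟶ Y} (hj : A.IsCoker j) :
    A.IsCoker (e.hom ≫ j) := by
  obtain ⟨K, k, w, hE⟩ := hj
  refine ⟨K, k ≫ e.inv, by simp [w], A.closed _ _ ⟨?_⟩ hE⟩
  exact ShortComplex.isoMk (Iso.refl _) e.symm (Iso.refl _) (by simp) (by simp)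

/-- If `z` is a zero object then `X ⟶ X ⟶ z` belongs to the class. -/
lemma right_zero_mem (X : C) {z : C} (hz : IsZero z) :
    A.E (ShortComplex.mk (𝟙 X) (0 : X ⟶ z) comp_zero) := by
  have : HasBinaryCoproduct X z := A.hasBinaryCoproduct X z
  let e : X ⨿ z ≅ X :=
    { hom := coprod.desc (𝟙 X) (0 : z ⟶ X)
      inv := coprod.inl
      hom_inv_id := coprod.hom_ext (by rw [coprod.inl_desc_assoc]; simp) (hz.eq_of_src _ _)
      inv_hom_id := coprod.inl_desc _ _ }
  refine A.closed _ _ ⟨?_⟩ (A.sum_mem X z)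
  exact ShortComplex.isoMk (Iso.refl X) e (Iso.refl z)
    ((Category.id_comp _).trans (coprod.inl_desc _ _).symm) (hz.eq_of_tgt _ _)

/-- If `z` is a zero object then `z ⟶ X ⟶ X` belongs to the class. -/
lemma left_zero_mem (X : C) {z : C} (hz : IsZero z) :
    A.E (ShortComplex.mk (0 : z ⟶ X) (𝟙 X) zero_comp) := by
  have : HasBinaryCoproduct z X := A.hasBinaryCoproduct z X
  let e : z ⨿ X ≅ X :=
    { hom := coprod.desc (0 : z ⟶ X) (𝟙 X)
      inv := coprod.inr
      hom_inv_id := coprod.hom_ext (hz.eq_of_src _ _) (by rw [coprod.inr_desc_assoc]; simp)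
      inv_hom_id := coprod.inr_desc _ _ }
  refine A.closed _ _ ⟨?_⟩ (A.sum_mem z X)
  exact ShortComplex.isoMk (Iso.refl z) e (Iso.refl X) (hz.eq_of_src _ _) rfl

variable (A)

lemma isKer_id (X : C) : A.IsKer (𝟙 X) := by
  obtain ⟨z, hz⟩ := A.hasZeroObject
  exact ⟨z, 0, _, right_zero_mem X hz⟩

lemma isCoker_id (X : C) : A.IsCoker (𝟙 X) := by
  obtain ⟨z, hz⟩ := A.hasZeroObject
  exact ⟨z, 0, _, left_zero_mem X hz⟩

lemma isKer_zero {z : C} (hz : IsZero z) (X : C) : A.IsKer (0 : z ⟶ X) :=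
  ⟨X, 𝟙 X, _, left_zero_mem X hz⟩

lemma isCoker_zero {z : C} (hz : IsZero z) (X : C) : A.IsCoker (0 : X ⟶ z) :=
  ⟨X, 𝟙 X, _, right_zero_mem X hz⟩

end Basic

/-! ### The category `QC` -/

/-- A diagram `X ⟵ S ⟶ Y` in which `S ⟶ Y` is an `E`-kernel and `S ⟶ X` is an `E`-cokernel. -/
structure QSpan (X Y : C) where
  S : C
  i : S ⟶ Y
  j : S ⟶ X
  isKer : A.IsKer i
  isCoker : A.IsCoker j

variable {A} in
/-- Two diagrams with the same ends are isomorphic if there is an isomorphism of their middle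
objects which commutes with the maps to the ends. -/
def QSpan.Isomorphic {X Y : C} (a b : A.QSpan X Y) : Prop :=
  ∃ e : a.S ≅ b.S, e.hom ≫ b.i = a.i ∧ e.hom ≫ b.j = a.j

/-- Isomorphism of diagrams is an equivalence relation. -/
instance qSpanSetoid (X Y : C) : Setoid (A.QSpan X Y) where
  r := QSpan.Isomorphic
  iseqv :=
    { refl := fun _ => ⟨Iso.refl _, by simp, by simp⟩
      symm := by
        rintro a b ⟨e, h1, h2⟩
        exact ⟨e.symm, by simp [← h1], by simp [← h2]⟩
      trans := by
        rintro a b c ⟨e, h1, h2⟩ ⟨f, h3, h4⟩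
        exact ⟨e ≪≫ f, by simp [h1, h3], by simp [h2, h4]⟩ }

namespace QSpan

variable {A}

/-- The diagram obtained from two composable diagrams `X ⟵ S ⟶ Y` and `Y ⟵ T ⟶ Z` by means of a
cartesian square with corner `P` over `S ⟶ Y ⟵ T`. -/
def compOfIsPullback {X Y Z : C} (a : A.QSpan X Y) (b : A.QSpan Y Z) {P : C} {p : P ⟶ a.S}
    {q : P ⟶ b.S} (h : IsPullback p q a.i b.j) : A.QSpan X Z where
  S := P
  i := q ≫ b.i
  j := p ≫ a.j
  isKer := A.kernel_comp _ _ (A.kernel_baseChange h a.isKer b.isCoker) b.isKer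
  isCoker := A.cokernel_comp _ _ (A.cokernel_baseChange h a.isKer b.isCoker) a.isCoker

lemma isPullback_pullback {X Y Z : C} (a : A.QSpan X Y) (b : A.QSpan Y Z) :
    haveI := hasPullback a.isKer b.isCoker
    IsPullback (pullback.fst a.i b.j) (pullback.snd a.i b.j) a.i b.j :=
  have := hasPullback a.isKer b.isCoker
  IsPullback.of_hasPullback _ _

/-- The composite of two diagrams, through the base change `S ×_Y T`. -/
noncomputable def comp {X Y Z : C} (a : A.QSpan X Y) (b : A.QSpan Y Z) : A.QSpan X Z :=
  compOfIsPullback a b (isPullback_pullback a b)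

lemma compOfIsPullback_congr {X Y Z : C} {a a' : A.QSpan X Y} {b b' : A.QSpan Y Z}
    (ha : a ≈ a') (hb : b ≈ b') {P : C} {p : P ⟶ a.S}
    {q : P ⟶ b.S} (h : IsPullback p q a.i b.j) {P' : C} {p' : P' ⟶ a'.S}
    {q' : P' ⟶ b'.S} (h' : IsPullback p' q' a'.i b'.j) :
    compOfIsPullback a b h ≈ compOfIsPullback a' b' h' := by
  obtain ⟨e, he1, he2⟩ := ha
  obtain ⟨f, hf1, hf2⟩ := hb
  have h2 : IsPullback (p ≫ e.hom) (q ≫ f.hom) a'.i b'.j :=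
    h.of_iso (Iso.refl _) e f (Iso.refl _) (by simp) (by simp) (by simp [he1]) (by simp [hf2])
  refine ⟨h2.isoIsPullback _ _ h', ?_, ?_⟩
  · simp [compOfIsPullback, hf1]
  · simp [compOfIsPullback, he2]

end QSpan

/-- The category `QC` has the same objects as `C`. -/
structure QCat {C : Type u} [Category.{v} C] [HasZeroMorphisms C]
    (A : QuasiExactStructure C) where
  /-- the object of `QC` given by an object of `C` -/
  of ::
  /-- the underlying object of `C` -/
  as : C

variable {A}

/-- The composition of isomorphism classes of diagrams. -/
noncomputable def qComp {X Y Z : C} (f : Quotient (A.qSpanSetoid X Y))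
    (g : Quotient (A.qSpanSetoid Y Z)) : Quotient (A.qSpanSetoid X Z) :=
  Quotient.map₂ QSpan.comp
    (fun _ _ ha _ _ hb => QSpan.compOfIsPullback_congr ha hb _ _) f g

lemma qComp_mk {X Y Z : C} (a : A.QSpan X Y) (b : A.QSpan Y Z) {P : C} {p : P ⟶ a.S}
    {q : P ⟶ b.S} (h : IsPullback p q a.i b.j) :
    qComp (Quotient.mk _ a) (Quotient.mk _ b) = Quotient.mk _ (QSpan.compOfIsPullback a b h) :=
  Quotient.sound (QSpan.compOfIsPullback_congr (Setoid.refl a) (Setoid.refl b) _ _)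

/-- The identity diagram. -/
def QSpan.id (A : QuasiExactStructure C) (X : C) : A.QSpan X X where
  S := X
  i := 𝟙 X
  j := 𝟙 X
  isKer := A.isKer_id X
  isCoker := A.isCoker_id X

lemma qComp_assoc {W X Y Z : C} (f : Quotient (A.qSpanSetoid W X))
    (g : Quotient (A.qSpanSetoid X Y)) (h : Quotient (A.qSpanSetoid Y Z)) :
    qComp (qComp f g) h = qComp f (qComp g h) := by
  induction f using Quotient.ind with | _ a
  induction g using Quotient.ind with | _ b
  induction h using Quotient.ind with | _ c
  have hab := QSpan.isPullback_pullback a b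
  have hbc := QSpan.isPullback_pullback b c
  rw [qComp_mk a b hab, qComp_mk b c hbc]
  have := hasPullback a.isKer b.isCoker
  have := hasPullback b.isKer c.isCoker
  have hq := A.kernel_baseChange hab a.isKer b.isCoker
  have hp := A.cokernel_baseChange hbc b.isKer c.isCoker
  have := hasPullback hq hp
  have hP := IsPullback.of_hasPullback (pullback.snd a.i b.j) (pullback.fst b.i c.j)
  have h1 := (hP.flip.paste_horiz hbc.flip).flip
  have h2 := hP.paste_horiz hab
  rw [qComp_mk (QSpan.compOfIsPullback a b hab) c h1,
    qComp_mk a (QSpan.compOfIsPullback b c hbc) h2]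
  refine Quotient.sound ⟨Iso.refl _, ?_, ?_⟩
  · simp [QSpan.compOfIsPullback]
  · simp [QSpan.compOfIsPullback]

lemma id_qComp {X Y : C} (f : Quotient (A.qSpanSetoid X Y)) :
    qComp (Quotient.mk _ (QSpan.id A X)) f = f := by
  induction f using Quotient.ind with | _ a
  rw [qComp_mk (QSpan.id A X) a (IsPullback.of_id_snd : IsPullback a.j (𝟙 a.S) (𝟙 X) a.j)]
  refine Quotient.sound ⟨Iso.refl _, ?_, ?_⟩
  · simp [QSpan.compOfIsPullback]
  · simp [QSpan.compOfIsPullback, QSpan.id]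

lemma qComp_id {X Y : C} (f : Quotient (A.qSpanSetoid X Y)) :
    qComp f (Quotient.mk _ (QSpan.id A Y)) = f := by
  induction f using Quotient.ind with | _ a
  rw [qComp_mk a (QSpan.id A Y) (IsPullback.of_id_fst : IsPullback (𝟙 a.S) a.i a.i (𝟙 Y))]
  refine Quotient.sound ⟨Iso.refl _, ?_, ?_⟩
  · simp [QSpan.compOfIsPullback, QSpan.id]
  · simp [QSpan.compOfIsPullback]

/-- Morphisms in `QC` are the isomorphism classes of diagrams, composed by base change. -/
noncomputable instance : Category.{max u v} A.QCat where
  Hom X Y := Quotient (A.qSpanSetoid X.as Y.as)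
  id X := Quotient.mk _ (QSpan.id A X.as)
  comp f g := qComp f g
  id_comp := id_qComp
  comp_id := qComp_id
  assoc := qComp_assoc

/-- The morphism `i_!` of `QC` given by an `E`-kernel `i : X ⟶ Y`. -/
def shriekLower {X Y : C} (i : X ⟶ Y) (hi : A.IsKer i) :
    (QCat.of X : A.QCat) ⟶ QCat.of Y :=
  Quotient.mk (A.qSpanSetoid X Y) ⟨X, i, 𝟙 X, hi, A.isCoker_id X⟩

/-- The morphism `j^!` of `QC` given by an `E`-cokernel `j : Y ⟶ X`. -/
def shriekUpper {X Y : C} (j : Y ⟶ X) (hj : A.IsCoker j) :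
    (QCat.of X : A.QCat) ⟶ QCat.of Y :=
  Quotient.mk (A.qSpanSetoid X Y) ⟨Y, 𝟙 Y, j, A.isKer_id Y, hj⟩

variable (A)

/-! ### The Grothendieck group -/

/-- The relations of the Grothendieck group: `[Y] = [X] + [Z]` for every sequence
`X ⟶ Y ⟶ Z` of the class. -/
def k0Relations : Set (FreeAbelianGroup C) :=
  {r | ∃ S : ShortComplex C, A.E S ∧ r = FreeAbelianGroup.of S.X₂ -
    (FreeAbelianGroup.of S.X₁ + FreeAbelianGroup.of S.X₃)}

/-- The Grothendieck group `K₀(C, E)`, written additively. -/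
abbrev K0 : Type u := FreeAbelianGroup C ⧸ AddSubgroup.closure A.k0Relations

/-- The class `[X]` of an object in the Grothendieck group. -/
def k0Class (X : C) : A.K0 := QuotientAddGroup.mk (FreeAbelianGroup.of X)

end QuasiExactStructure

/-! ### Classifying spaces -/

section ClassifyingSpace

variable (D : Type u) [Category.{v} D]

/-- The classifying space of a category is the geometric realization of its nerve. -/
noncomputable abbrev ClassifyingSpace : TopCat.{max u v} := SSet.toTop.obj (nerve D)

variable {D}

/-- The point of the classifying space given by an object. -/
noncomputable def point (x : D) : ClassifyingSpace D :=
  TopCat.toSSetObj₀Equiv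
    ((sSetTopAdj.unit.app (nerve D)).app (op ⦋0⦌) (ComposableArrows.mk₀ x))

/-- The path in the classifying space given by a morphism `f : x ⟶ y`: it runs from `x` to `y`
through the `1`-simplex `f` of the nerve. -/
noncomputable def edgePath {x y : D} (f : x ⟶ y) : Path (point x) (point y) where
  toFun t := TopCat.toSSetObj₁Equiv
    ((sSetTopAdj.unit.app (nerve D)).app (op ⦋1⦌) (ComposableArrows.mk₁ f)) (ULift.up t)
  continuous_toFun := (TopCat.Hom.hom (TopCat.toSSetObj₁Equiv
    ((sSetTopAdj.unit.app (nerve D)).app (op ⦋1⦌) (ComposableArrows.mk₁ f)))).continuous.comp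
      continuous_uliftUp
  source' := by
    refine (TopCat.toSSetObj₁Equiv_apply_zero _).trans ?_
    refine congrArg TopCat.toSSetObj₀Equiv ?_
    refine (SSet.δ_naturality_apply (sSetTopAdj.unit.app (nerve D)) 1
      (ComposableArrows.mk₁ f)).symm.trans ?_
    exact congrArg _ (ComposableArrows.ext₀ rfl)
  target' := by
    refine (TopCat.toSSetObj₁Equiv_apply_one _).trans ?_
    refine congrArg TopCat.toSSetObj₀Equiv ?_
    refine (SSet.δ_naturality_apply (sSetTopAdj.unit.app (nerve D)) 0
      (ComposableArrows.mk₁ f)).symm.trans ?_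
    exact congrArg _ (ComposableArrows.ext₀ rfl)

end ClassifyingSpace

namespace QuasiExactStructure

variable {C : Type u} [Category.{v} C] [HasZeroMorphisms C] (A : QuasiExactStructure C)

/-- The loop at a zero object `z` in the classifying space of `QC` given by an object `X`: it runs
from `z` to `X` along `j^!`, where `j` is the map `X ⟶ z`, and back along `i_!`, where `i` is the
map `z ⟶ X`. -/
noncomputable def canonicalLoop {z : C} (hz : IsZero z) (X : C) :
    Path (point (QCat.of z : A.QCat)) (point (QCat.of z : A.QCat)) :=
  (edgePath (shriekUpper (0 : X ⟶ z) (A.isCoker_zero hz X))).trans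
    (edgePath (shriekLower (0 : z ⟶ X) (A.isKer_zero hz X))).symm

end QuasiExactStructure

end QuasiExact

/-!
The isomorphism `K₀ → π₁` exists because the loops `[X]` satisfy the defining relations of `K₀`,
generate `π₁`, and can be told apart by a homomorphism `π₁ → K₀`.

*Relations.* Edges of the nerve compose up to homotopy, so that there is a functor (`edgeFunctor`)
from `QC` to the fundamental groupoid. Base change along `0 → X` of a sequence `K → Y → X` gives
`i_{X!} ≫ j^! = j_K^! ≫ k_!` in `QC`, and any functor to a groupoid turns this into the relation
`loop Y = loop K * loop X` (`loop_eq_of_mem`). The two sequences of a sum `X ⊕ Y` show that the loops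
commute (`loop_mul_comm`).

*Generators.* Every path between vertices is homotopic to a concatenation of edges
(`EdgeClosed.all`), and up to the paths `i_{X!}` every edge is one of the loops, because each morphism
of `QC` is a composite `j^! ≫ i_!` (`exists_map_eq_loop`). The statement on paths is proved by cellular
approximation: a path meets the interiors of simplices of bounded dimension, and it can be pushed off
the interiors of the simplices of top dimension, up to pieces which lie in one simplex
(`path_induction_realization`).

*Independence.* The label `[S] - [X]` of a morphism `X ⟵ S ⟶ Y` is multiplicative, since the two
parallel cokernels of a cartesian square have isomorphic kernels (`isLabelling_k0Label`). Any
multiplicative labelling of the morphisms of a category by elements of a group `G` extends to the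
classes of paths in its classifying space (`IsLabelling.exists_extension`). For this the classifying
space is mapped to the orbit space of the action of `G` on the step functions `[0, 1) → G`: a
point of a simplex goes to the step function whose values are the labels of the morphisms from the
first vertex, and whose steps have the barycentric coordinates as lengths. The projection to the
orbit space is a covering with group `G`, and the label of a path is its monodromy. The label
of the loop of `X` is `[X]`.
-/

/-! ### Simplices and maps out of a geometric realization -/

namespace QuasiExact

section Cells

variable {X : SSet.{u}}

/-- The characteristic map of a simplex. -/
noncomputable def cell {n : ℕ} (σ : X _⦋n⦌) : C(stdSimplex ℝ (Fin (n + 1)), SSet.toTop.obj X) :=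
  TopCat.toSSetObjEquiv _ (op ⦋n⦌) ((sSetTopAdj.unit.app X).app (op ⦋n⦌) σ)

/-- The characteristic map of `θ^* σ` is that of `σ`, precomposed with the affine map of simplices
given by `θ`. -/
lemma cell_map {m n : ℕ} (θ : ⦋m⦌ ⟶ ⦋n⦌) (σ : X _⦋n⦌) (t : stdSimplex ℝ (Fin (m + 1))) :
    cell (X.map θ.op σ) t = cell σ (stdSimplex.map θ t) := by
  have h := NatTrans.naturality_apply (sSetTopAdj.unit.app X) θ.op σ
  dsimp only [cell]
  erw [h]
  rfl

/-- The continuous map out of a geometric realization given by a compatible family of maps on the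
simplices. -/
lemma exists_desc {Y : TopCat.{u}}
    (f : ∀ n, X _⦋n⦌ → C(stdSimplex ℝ (Fin (n + 1)), Y))
    (hf : ∀ {m n : ℕ} (θ : ⦋m⦌ ⟶ ⦋n⦌) (σ : X _⦋n⦌) (t : stdSimplex ℝ (Fin (m + 1))),
      f m (X.map θ.op σ) t = f n σ (stdSimplex.map θ t)) :
    ∃ F : C(SSet.toTop.obj X, Y), ∀ {n : ℕ} (σ : X _⦋n⦌) (t : stdSimplex ℝ (Fin (n + 1))),
      F (cell σ t) = f n σ t := by
  let g : X ⟶ TopCat.toSSet.obj Y :=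
    { app n := TypeCat.ofHom fun σ => (TopCat.toSSetObjEquiv Y n).symm (f n.unop.len σ)
      naturality := by
        intro n m θ
        ext σ
        apply (TopCat.toSSetObjEquiv Y m).injective
        ext t
        exact hf θ.unop σ t }
  have hg : sSetTopAdj.unit.app X ≫ TopCat.toSSet.map ((sSetTopAdj.homEquiv X Y).symm g) = g := by
    exact (sSetTopAdj.homEquiv_unit _ _ _).symm.trans (Equiv.apply_symm_apply _ _)
  refine ⟨TopCat.Hom.hom ((sSetTopAdj.homEquiv X Y).symm g), fun {n} σ t => ?_⟩
  have h := congrArg (fun k => TopCat.toSSetObjEquiv Y _ (k.app (op ⦋n⦌) σ) t) hg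
  exact h

lemma hom_ext_cell {Y : TopCat.{u}} {F G : SSet.toTop.obj X ⟶ Y}
    (h : ∀ {n : ℕ} (σ : X _⦋n⦌) (t : stdSimplex ℝ (Fin (n + 1))), F (cell σ t) = G (cell σ t)) :
    F = G := by
  apply (sSetTopAdj.homEquiv X Y).injective
  ext n σ
  apply (TopCat.toSSetObjEquiv Y n).injective
  ext t
  rw [Adjunction.homEquiv_unit, Adjunction.homEquiv_unit]
  exact h (n := n.unop.len) σ t

/-- A type with the indiscrete topology, for which every function into it is continuous. -/
def Indiscrete (S : Type u) : Type u := S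

instance (S : Type u) : TopologicalSpace (Indiscrete S) := ⊤

lemma continuous_indiscrete {W : Type*} [TopologicalSpace W] {S : Type u}
    (f : W → Indiscrete S) : Continuous f :=
  continuous_top

/-- The function, not necessarily continuous, on the points of a geometric realization which is
given by a compatible family of functions on the simplices. -/
lemma exists_function_desc {S : Type u} (f : ∀ n, X _⦋n⦌ → stdSimplex ℝ (Fin (n + 1)) → S)
    (hf : ∀ {m n : ℕ} (θ : ⦋m⦌ ⟶ ⦋n⦌) (σ : X _⦋n⦌) (t : stdSimplex ℝ (Fin (m + 1))),
      f m (X.map θ.op σ) t = f n σ (stdSimplex.map θ t)) :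
    ∃ F : SSet.toTop.obj X → S, ∀ {n : ℕ} (σ : X _⦋n⦌) (t : stdSimplex ℝ (Fin (n + 1))),
      F (cell σ t) = f n σ t := by
  obtain ⟨F, hF⟩ := exists_desc (Y := TopCat.of (Indiscrete S))
    (fun n σ => ⟨f n σ, continuous_indiscrete _⟩) hf
  exact ⟨F, hF⟩

/-- Every point of the realization lies on a simplex: otherwise the indicator function of the points
which do would be a second function with constant value `True` on all simplices. -/
lemma exists_cell (y : SSet.toTop.obj X) :
    ∃ (n : ℕ) (σ : X _⦋n⦌) (t : stdSimplex ℝ (Fin (n + 1))), cell σ t = y := by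
  let p (y : SSet.toTop.obj X) : Prop :=
    ∃ (n : ℕ) (σ : X _⦋n⦌) (t : stdSimplex ℝ (Fin (n + 1))), cell σ t = y
  let F : SSet.toTop.obj X ⟶ TopCat.of (Indiscrete (ULift.{u} Prop)) :=
    TopCat.ofHom ⟨fun _ => ULift.up True, continuous_indiscrete _⟩
  let G : SSet.toTop.obj X ⟶ TopCat.of (Indiscrete (ULift.{u} Prop)) :=
    TopCat.ofHom ⟨fun y => ULift.up (p y), continuous_indiscrete _⟩
  have h : F = G := hom_ext_cell fun {n} σ t => ULift.ext (ULift.up True) (ULift.up (p (cell σ t)))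
    (eq_true (⟨n, σ, t, rfl⟩ : p (cell σ t))).symm
  have h' : True = p y := congrArg ULift.down (ConcreteCategory.congr_hom h y)
  exact of_eq_true h'.symm

variable (X) in
/-- The set of points of a geometric realization, with the final topology for the characteristic
maps. -/
noncomputable def FinalRealization : Type u := SSet.toTop.obj X

noncomputable instance : TopologicalSpace (FinalRealization X) :=
  ⨆ p : Σ n, X _⦋n⦌, TopologicalSpace.coinduced (cell p.2) inferInstance

/-- The geometric realization carries the final topology for the characteristic maps: by its universal
property the identity is continuous as a map to `FinalRealization X`. -/
lemma isClosed_iff_cell (F : Set (SSet.toTop.obj X)) :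
    IsClosed F ↔ ∀ (n : ℕ) (σ : X _⦋n⦌), IsClosed (cell σ ⁻¹' F) := by
  refine ⟨fun h n σ => h.preimage (cell σ).continuous, fun h => ?_⟩
  let c {n : ℕ} (σ : X _⦋n⦌) (t : stdSimplex ℝ (Fin (n + 1))) : FinalRealization X := cell σ t
  have hc {n : ℕ} (σ : X _⦋n⦌) : Continuous (c σ) :=
    continuous_iff_coinduced_le.2
      (le_iSup (fun p : Σ n, X _⦋n⦌ => TopologicalSpace.coinduced (cell p.2) inferInstance) ⟨n, σ⟩)
  let ι : FinalRealization X → SSet.toTop.obj X := id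
  have hid : Continuous ι :=
    continuous_iff_coinduced_le.2 (by
      erw [coinduced_id]
      exact iSup_le fun p => (cell p.2).continuous.coinduced_le)
  obtain ⟨G, hG⟩ := exists_desc (Y := TopCat.of (FinalRealization X)) (fun n σ => ⟨c σ, hc σ⟩)
    (fun θ σ t => cell_map θ σ t)
  let H : SSet.toTop.obj X ⟶ SSet.toTop.obj X :=
    TopCat.ofHom ⟨fun y => ι (G y), hid.comp (map_continuous G)⟩
  have hH : H = 𝟙 _ := hom_ext_cell fun σ t => hG σ t
  have hG' (y) : G y = y := ConcreteCategory.congr_hom hH y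
  have hF : IsClosed (ι ⁻¹' F) := by
    rw [isClosed_iSup_iff]
    exact fun p => isClosed_coinduced.2 (h _ p.2)
  have := hF.preimage (map_continuous G)
  rwa [show G ⁻¹' (ι ⁻¹' F) = F from
    Set.ext fun y => by
      rw [Set.mem_preimage, Set.mem_preimage]
      exact (congrArg (· ∈ F) (hG' y)).to_iff] at this

end Cells

section Simplex

lemma stdSimplex_map_apply {m n : ℕ} (f : Fin (m + 1) → Fin (n + 1))
    (t : stdSimplex ℝ (Fin (m + 1))) (j : Fin (n + 1)) :
    stdSimplex.map f t j = ∑ i with f i = j, t i := by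
  rw [stdSimplex.map_coe, FunOnFinite.linearMap_apply_apply]

lemma stdSimplex_map_apply_of_injective {m n : ℕ} {f : Fin (m + 1) → Fin (n + 1)}
    (hf : Function.Injective f) (t : stdSimplex ℝ (Fin (m + 1))) (i : Fin (m + 1)) :
    stdSimplex.map f t (f i) = t i := by
  rw [stdSimplex_map_apply, Finset.sum_eq_single i]
  · intro b hb hbi
    exact absurd (hf (Finset.mem_filter.1 hb).2) hbi
  · simp

lemma stdSimplex_map_pos_iff {m n : ℕ} {f : Fin (m + 1) → Fin (n + 1)}
    {t : stdSimplex ℝ (Fin (m + 1))} (ht : ∀ i, 0 < t i) (j : Fin (n + 1)) :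
    0 < stdSimplex.map f t j ↔ j ∈ Set.range f := by
  rw [stdSimplex_map_apply]
  constructor
  · intro h
    by_contra hj
    rw [Finset.sum_eq_zero] at h
    · exact h.false
    · intro i hi
      exact absurd ⟨i, (Finset.mem_filter.1 hi).2⟩ hj
  · rintro ⟨i, rfl⟩
    exact Finset.sum_pos (fun i _ => ht i) ⟨i, by simp⟩

/-- A point of a simplex with a vanishing coordinate lies on the opposite face. -/
lemma exists_map_δ_eq {n : ℕ} (t : stdSimplex ℝ (Fin (n + 2))) (i : Fin (n + 2)) (h : t i = 0) :
    ∃ s : stdSimplex ℝ (Fin (n + 1)), stdSimplex.map (SimplexCategory.δ i) s = t := by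
  have h1 : ∑ j : Fin (n + 1), t (i.succAbove j) = 1 := by
    have := stdSimplex.sum_eq_one t
    rwa [Fin.sum_univ_succAbove _ i, h, zero_add] at this
  let s : stdSimplex ℝ (Fin (n + 1)) :=
    ⟨fun j => t (i.succAbove j), fun j => stdSimplex.zero_le t _, h1⟩
  refine ⟨s, ?_⟩
  ext j
  have hinj : Function.Injective (SimplexCategory.δ i) := Fin.succAbove_right_injective
  by_cases hj : j = i
  · subst hj
    rw [h, stdSimplex_map_apply, Finset.sum_eq_zero]
    intro k hk
    exact absurd (Finset.mem_filter.1 hk).2 (Fin.succAbove_ne j k)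
  · obtain ⟨k, rfl⟩ := Fin.exists_succAbove_eq hj
    exact stdSimplex_map_apply_of_injective hinj s k

lemma stdSimplex_map_id {n : ℕ} (t : stdSimplex ℝ (Fin (n + 1))) :
    stdSimplex.map (𝟙 ⦋n⦌ : ⦋n⦌ ⟶ ⦋n⦌) t = t := by
  have h : ⇑(ConcreteCategory.hom (𝟙 ⦋n⦌)) = id := rfl
  rw [h, stdSimplex.map_id_apply]

lemma stdSimplex_map_comp {l m n : ℕ} (f : ⦋l⦌ ⟶ ⦋m⦌) (g : ⦋m⦌ ⟶ ⦋n⦌)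
    (t : stdSimplex ℝ (Fin (l + 1))) :
    stdSimplex.map (f ≫ g) t = stdSimplex.map g (stdSimplex.map f t) := by
  have h : ⇑(ConcreteCategory.hom (f ≫ g)) =
    ConcreteCategory.hom g ∘ ConcreteCategory.hom f := rfl
  rw [h, stdSimplex.map_comp_apply]

/-- Every point of a simplex is an interior point of a face. -/
lemma exists_face {n : ℕ} (t : stdSimplex ℝ (Fin (n + 1))) :
    ∃ (k : ℕ) (δ : ⦋k⦌ ⟶ ⦋n⦌) (_ : Mono δ) (r : stdSimplex ℝ (Fin (k + 1))),
      (∀ i, 0 < r i) ∧ stdSimplex.map δ r = t := by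
  induction n with
  | zero =>
    refine ⟨0, 𝟙 _, inferInstance, t, fun i => ?_, stdSimplex_map_id t⟩
    rw [Subsingleton.elim t default]
    exact one_pos
  | succ n ih =>
    by_cases h : ∀ i, 0 < t i
    · exact ⟨n + 1, 𝟙 _, inferInstance, t, h, stdSimplex_map_id t⟩
    · push Not at h
      obtain ⟨i, hi⟩ := h
      obtain ⟨s, rfl⟩ := exists_map_δ_eq t i (le_antisymm hi (stdSimplex.zero_le t i))
      obtain ⟨k, δ, _, r, hr, rfl⟩ := ih s
      exact ⟨k, δ ≫ SimplexCategory.δ i, mono_comp _ _, r, hr,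
        stdSimplex_map_comp _ _ _⟩

/-- A point of a simplex is an interior point of only one face. -/
lemma face_unique {n k k' : ℕ} {δ : ⦋k⦌ ⟶ ⦋n⦌} {δ' : ⦋k'⦌ ⟶ ⦋n⦌} [Mono δ] [Mono δ']
    {r : stdSimplex ℝ (Fin (k + 1))} {r' : stdSimplex ℝ (Fin (k' + 1))}
    (hr : ∀ i, 0 < r i) (hr' : ∀ i, 0 < r' i)
    (h : stdSimplex.map δ r = stdSimplex.map δ' r') :
    (⟨k, δ, r⟩ : Σ k, (⦋k⦌ ⟶ ⦋n⦌) × stdSimplex ℝ (Fin (k + 1))) = ⟨k', δ', r'⟩ := by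
  have hδ : Function.Injective (δ : Fin (k + 1) → Fin (n + 1)) :=
    SimplexCategory.mono_iff_injective.1 ‹Mono δ›
  have hδ' : Function.Injective (δ' : Fin (k' + 1) → Fin (n + 1)) :=
    SimplexCategory.mono_iff_injective.1 ‹Mono δ'›
  have hrange : Set.range (δ : Fin (k + 1) → Fin (n + 1)) =
      Set.range (δ' : Fin (k' + 1) → Fin (n + 1)) := by
    ext j
    rw [← stdSimplex_map_pos_iff hr j, ← stdSimplex_map_pos_iff hr' j, h]
  obtain rfl : k = k' := by
    have h1 := Nat.card_range_of_injective hδ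
    have h2 := Nat.card_range_of_injective hδ'
    rw [hrange, h2] at h1
    simpa using h1.symm
  obtain rfl : δ = δ' := by
    apply SimplexCategory.Hom.ext
    ext i : 2
    exact congrFun ((StrictMono.range_inj (δ.toOrderHom.monotone.strictMono_of_injective hδ)
      (δ'.toOrderHom.monotone.strictMono_of_injective hδ')).1 hrange) i
  obtain rfl : r = r' := by
    ext i
    rw [← stdSimplex_map_apply_of_injective hδ, h, stdSimplex_map_apply_of_injective hδ]
  rfl

lemma exists_epi_mono {a b : ℕ} (f : ⦋a⦌ ⟶ ⦋b⦌) :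
    ∃ (k : ℕ) (e : ⦋a⦌ ⟶ ⦋k⦌) (m : ⦋k⦌ ⟶ ⦋b⦌), Epi e ∧ Mono m ∧ e ≫ m = f :=
  ⟨(image f).len, factorThruImage f, image.ι f, inferInstance, inferInstance, image.fac f⟩

end Simplex
end QuasiExact

/-! ### The normal form of a point of a geometric realization -/

namespace QuasiExact

section NormalForm

variable {X : SSet.{u}}

variable (X) in
/-- A nondegenerate simplex together with a point of the topological simplex of its dimension. -/
abbrev CellPoint : Type u := Σ m, X.nonDegenerate m × stdSimplex ℝ (Fin (m + 1))

/-- `N` is the normal form of the point `t` of the simplex `σ`: the face of `σ` which has `t` in its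
interior degenerates to the nondegenerate simplex of `N`, and `t` is mapped to the point of `N`. -/
def IsNormalForm {n : ℕ} (σ : X _⦋n⦌) (t : stdSimplex ℝ (Fin (n + 1))) (N : CellPoint X) : Prop :=
  ∃ (k : ℕ) (δ : ⦋k⦌ ⟶ ⦋n⦌) (p : ⦋k⦌ ⟶ ⦋N.1⦌) (r : stdSimplex ℝ (Fin (k + 1))),
    Mono δ ∧ Epi p ∧ (∀ i, 0 < r i) ∧ stdSimplex.map δ r = t ∧ stdSimplex.map p r = N.2.2 ∧
      X.map δ.op σ = X.map p.op N.2.1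

lemma exists_isNormalForm {n : ℕ} (σ : X _⦋n⦌) (t : stdSimplex ℝ (Fin (n + 1))) :
    ∃ N, IsNormalForm σ t N := by
  obtain ⟨k, δ, hδ, r, hr, rfl⟩ := exists_face t
  obtain ⟨m, p, hp, y, hy⟩ := X.exists_nonDegenerate (X.map δ.op σ)
  exact ⟨⟨m, y, stdSimplex.map p r⟩, k, δ, p, r, hδ, hp, hr, rfl, rfl, hy⟩

lemma IsNormalForm.unique {n : ℕ} {σ : X _⦋n⦌} {t : stdSimplex ℝ (Fin (n + 1))}
    {N N' : CellPoint X} (h : IsNormalForm σ t N) (h' : IsNormalForm σ t N') : N = N' := by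
  obtain ⟨k, δ, p, r, hδ, hp, hr, ht, hs, hσ⟩ := h
  obtain ⟨k', δ', p', r', hδ', hp', hr', ht', hs', hσ'⟩ := h'
  have h := face_unique hr hr' (ht.trans ht'.symm)
  obtain ⟨rfl, h⟩ := Sigma.mk.inj_iff.1 h
  obtain ⟨rfl, rfl⟩ := Prod.mk.inj (eq_of_heq h)
  obtain ⟨m, y, s⟩ := N
  obtain ⟨m', y', s'⟩ := N'
  dsimp only at p p' hs hs' hσ hσ'
  obtain rfl := X.unique_nonDegenerate_dim _ p y hσ p' y' hσ'
  obtain rfl := X.unique_nonDegenerate_simplex _ p y hσ p' y' hσ'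
  obtain rfl := X.unique_nonDegenerate_map _ p y hσ p' y hσ'
  rw [← hs, ← hs']

/-- The normal form is compatible with the simplicial structure, by the uniqueness of the
nondegenerate simplex under a simplex (the Eilenberg–Zilber lemma). -/
lemma IsNormalForm.of_map {m n : ℕ} {θ : ⦋m⦌ ⟶ ⦋n⦌} {σ : X _⦋n⦌}
    {t : stdSimplex ℝ (Fin (m + 1))} {N : CellPoint X} (h : IsNormalForm (X.map θ.op σ) t N) :
    IsNormalForm σ (stdSimplex.map θ t) N := by
  obtain ⟨k, δ, p, r, hδ, hp, hr, rfl, hs, hσ⟩ := h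
  obtain ⟨l, e, δ', he, hδ', hfac⟩ := exists_epi_mono (δ ≫ θ)
  obtain ⟨m', p', hp', y', hy'⟩ := X.exists_nonDegenerate (X.map δ'.op σ)
  have h1 : X.map p.op N.2.1.1 = X.map (e ≫ p').op y' := by
    rw [← hσ, op_comp, Functor.map_comp_apply, ← hy', ← Functor.map_comp_apply,
      ← Functor.map_comp_apply, ← op_comp, ← op_comp, hfac]
  obtain ⟨q, y, s⟩ := N
  dsimp only at p hs h1
  obtain rfl := X.unique_nonDegenerate_dim _ p y rfl (e ≫ p') y' h1
  obtain rfl := X.unique_nonDegenerate_simplex _ p y rfl (e ≫ p') y' h1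
  obtain rfl := X.unique_nonDegenerate_map _ p y rfl (e ≫ p') y h1
  refine ⟨l, δ', p', stdSimplex.map e r, hδ', hp', fun i => ?_, ?_, ?_, hy'⟩
  · rw [stdSimplex_map_pos_iff hr]
    exact SimplexCategory.epi_iff_surjective.1 he i
  · rw [← stdSimplex_map_comp, hfac, stdSimplex_map_comp]
  · rw [← hs, stdSimplex_map_comp]

/-- Every point of a geometric realization is an interior point of exactly one nondegenerate
simplex. -/
lemma exists_normalForm : ∃ F : SSet.toTop.obj X → CellPoint X,
    (∀ y, cell (F y).2.1.1 (F y).2.2 = y) ∧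
    ∀ {n : ℕ} (σ : X.nonDegenerate n) (t : stdSimplex ℝ (Fin (n + 1))), (∀ i, 0 < t i) →
      F (cell σ.1 t) = ⟨n, σ, t⟩ := by
  choose N hN using fun (n : ℕ) (σ : X _⦋n⦌) (t : stdSimplex ℝ (Fin (n + 1))) =>
    exists_isNormalForm σ t
  obtain ⟨F, hF⟩ := exists_function_desc N
    fun θ σ t => (hN _ _ _).of_map.unique (hN _ _ _)
  refine ⟨F, fun y => ?_, fun {n} σ t ht => ?_⟩
  · obtain ⟨n, σ, t, rfl⟩ := exists_cell y
    obtain ⟨k, δ, p, r, -, -, -, h1, h2, h3⟩ := hN n σ t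
    rw [hF, ← h2, ← cell_map, ← h3, cell_map, h1]
  · rw [hF]
    refine (hN n σ.1 t).unique ⟨n, 𝟙 _, 𝟙 _, t, inferInstance, inferInstance, ht,
      stdSimplex_map_id t, stdSimplex_map_id t, rfl⟩

/-- The nondegenerate simplex which has a given point of the realization in its interior, and the
coordinates of the point in this simplex. -/
noncomputable def normalForm (y : SSet.toTop.obj X) : CellPoint X := exists_normalForm.choose y

/-- The dimension of the nondegenerate simplex which has a given point in its interior. -/
noncomputable def cellDim (y : SSet.toTop.obj X) : ℕ := (normalForm y).1

lemma cell_normalForm (y : SSet.toTop.obj X) :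
    cell (normalForm y).2.1.1 (normalForm y).2.2 = y :=
  exists_normalForm.choose_spec.1 y

lemma normalForm_cell {n : ℕ} (σ : X.nonDegenerate n) {t : stdSimplex ℝ (Fin (n + 1))}
    (ht : ∀ i, 0 < t i) : normalForm (cell σ.1 t) = ⟨n, σ, t⟩ :=
  exists_normalForm.choose_spec.2 σ t ht

/-- To prove a property of the points of simplices, it suffices to prove it for the interior points
of nondegenerate simplices, and to know that it is invariant under face and degeneracy maps. -/
lemma simplexPoint_induction {P : ∀ n, X _⦋n⦌ → stdSimplex ℝ (Fin (n + 1)) → Prop}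
    (hint : ∀ n (σ : X.nonDegenerate n) t, (∀ i, 0 < t i) → P n σ.1 t)
    (hface : ∀ n (i : Fin (n + 2)) (σ : X _⦋n + 1⦌) t,
      P n (X.map (SimplexCategory.δ i).op σ) t →
        P (n + 1) σ (stdSimplex.map (SimplexCategory.δ i) t))
    (hdeg : ∀ n (i : Fin (n + 1)) (σ : X _⦋n⦌) t,
      P n σ (stdSimplex.map (SimplexCategory.σ i) t) →
        P (n + 1) (X.map (SimplexCategory.σ i).op σ) t)
    (n : ℕ) (σ : X _⦋n⦌) (t : stdSimplex ℝ (Fin (n + 1))) : P n σ t := by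
  induction n with
  | zero =>
    refine hint 0 ⟨σ, by simp⟩ t fun i => ?_
    rw [Subsingleton.elim t default]
    exact one_pos
  | succ n ih =>
    by_cases hσ : σ ∈ X.nonDegenerate (n + 1)
    · by_cases ht : ∀ i, 0 < t i
      · exact hint _ ⟨σ, hσ⟩ t ht
      · push Not at ht
        obtain ⟨i, hi⟩ := ht
        obtain ⟨s, rfl⟩ := exists_map_δ_eq t i (le_antisymm hi (stdSimplex.zero_le t i))
        exact hface n i σ s (ih _ _)
    · rw [← SSet.mem_degenerate_iff_notMem_nonDegenerate, SSet.degenerate_eq_iUnion_range_σ] at hσ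
      simp only [Set.mem_iUnion, Set.mem_range] at hσ
      obtain ⟨i, τ, rfl⟩ := hσ
      exact hdeg n i τ t (ih _ _)

lemma cellDim_cell_le {n : ℕ} (σ : X _⦋n⦌) (t : stdSimplex ℝ (Fin (n + 1))) :
    cellDim (cell σ t) ≤ n := by
  refine simplexPoint_induction (P := fun n σ t => cellDim (cell σ t) ≤ n) ?_ ?_ ?_ n σ t
  · intro n σ t ht
    rw [cellDim, normalForm_cell σ ht]
  · intro n i σ t h
    rw [cell_map] at h
    exact h.trans n.le_succ
  · intro n i σ t h
    rw [cell_map]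
    exact h.trans n.le_succ

lemma cellDim_cell_of_pos {n : ℕ} (σ : X.nonDegenerate n) {t : stdSimplex ℝ (Fin (n + 1))}
    (ht : ∀ i, 0 < t i) : cellDim (cell σ.1 t) = n := by
  rw [cellDim, normalForm_cell σ ht]

lemma cellDim_cell_lt {n : ℕ} (σ : X _⦋n⦌) {t : stdSimplex ℝ (Fin (n + 1))} {i : Fin (n + 1)}
    (hi : t i = 0) : cellDim (cell σ t) < n := by
  cases n with
  | zero =>
    rw [Subsingleton.elim t default] at hi
    exact absurd hi one_ne_zero
  | succ n =>
    obtain ⟨s, rfl⟩ := exists_map_δ_eq t i hi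
    rw [← cell_map]
    exact Nat.lt_succ_of_le (cellDim_cell_le _ _)

/-- A criterion for closedness in a geometric realization in terms of the interiors of the
nondegenerate simplices. The set `K n σ` need not contain all the boundary points of `σ` which are
mapped to `F`: these are taken care of by induction on the dimension. -/
lemma isClosed_of_nonDegenerate {F : Set (SSet.toTop.obj X)}
    (K : ∀ n, X.nonDegenerate n → Set (stdSimplex ℝ (Fin (n + 1))))
    (hK : ∀ n σ, IsClosed (K n σ))
    (h₁ : ∀ n (σ : X.nonDegenerate n) t, (∀ i, 0 < t i) → cell σ.1 t ∈ F → t ∈ K n σ)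
    (h₂ : ∀ n (σ : X.nonDegenerate n) t, t ∈ K n σ → cell σ.1 t ∈ F) : IsClosed F := by
  rw [isClosed_iff_cell]
  intro n
  induction n with
  | zero =>
    intro σ
    exact (Set.subsingleton_of_subsingleton).isClosed
  | succ n ih =>
    intro σ
    by_cases hσ : σ ∈ X.nonDegenerate (n + 1)
    · have : cell σ ⁻¹' F = K _ ⟨σ, hσ⟩ ∪ ⋃ i : Fin (n + 2),
          stdSimplex.map (SimplexCategory.δ i) ''
            (cell (X.map (SimplexCategory.δ i).op σ) ⁻¹' F) := by
        ext t
        simp only [Set.mem_preimage, Set.mem_union, Set.mem_iUnion, Set.mem_image]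
        constructor
        · intro h
          by_cases ht : ∀ i, 0 < t i
          · exact Or.inl (h₁ _ ⟨σ, hσ⟩ t ht h)
          · push Not at ht
            obtain ⟨i, hi⟩ := ht
            obtain ⟨s, rfl⟩ := exists_map_δ_eq t i (le_antisymm hi (stdSimplex.zero_le t i))
            exact Or.inr ⟨i, s, by rwa [cell_map], rfl⟩
        · rintro (h | ⟨i, s, hs, rfl⟩)
          · exact h₂ _ ⟨σ, hσ⟩ t h
          · rwa [cell_map] at hs
      rw [this]
      refine (hK _ _).union (isClosed_iUnion_of_finite fun i => ?_)
      exact ((ih _).isCompact.image (stdSimplex.continuous_map _)).isClosed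
    · rw [← SSet.mem_degenerate_iff_notMem_nonDegenerate, SSet.degenerate_eq_iUnion_range_σ] at hσ
      simp only [Set.mem_iUnion, Set.mem_range] at hσ
      obtain ⟨i, τ, rfl⟩ := hσ
      have : cell (X.σ i τ) ⁻¹' F =
          stdSimplex.map (SimplexCategory.σ i) ⁻¹' (cell τ ⁻¹' F) := by
        ext t
        rw [Set.mem_preimage, Set.mem_preimage, Set.mem_preimage, ← cell_map]
        rfl
      rw [this]
      exact (ih τ).preimage (stdSimplex.continuous_map _)

end NormalForm
end QuasiExact

/-! ### Segments and deformations in the standard simplex -/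

namespace QuasiExact

section Segment

variable {n : ℕ}

/-- The straight path between two points of a simplex. -/
noncomputable def simplexSegment (s t : stdSimplex ℝ (Fin (n + 1))) : Path s t where
  toFun u := ⟨fun i => (1 - (u : ℝ)) * s i + u * t i,
    fun i => add_nonneg (mul_nonneg (sub_nonneg.2 u.2.2) (stdSimplex.zero_le s i))
      (mul_nonneg u.2.1 (stdSimplex.zero_le t i)), by
    rw [Finset.sum_add_distrib, ← Finset.mul_sum, ← Finset.mul_sum, stdSimplex.sum_eq_one,
      stdSimplex.sum_eq_one]
    ring⟩
  continuous_toFun := by fun_prop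
  source' := by ext i; change (1 - (0 : ℝ)) * s i + 0 * t i = s i; ring
  target' := by ext i; change (1 - (1 : ℝ)) * s i + 1 * t i = t i; ring

lemma simplexSegment_apply (s t : stdSimplex ℝ (Fin (n + 1))) (u : unitInterval) (i : Fin (n + 1)) :
    simplexSegment s t u i = (1 - (u : ℝ)) * s i + u * t i := rfl

lemma simplexSegment_self (t : stdSimplex ℝ (Fin (n + 1))) (u : unitInterval) :
    simplexSegment t t u = t := by
  ext i
  rw [simplexSegment_apply]
  ring

lemma map_simplexSegment {m : ℕ} (f : Fin (n + 1) → Fin (m + 1))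
    (s t : stdSimplex ℝ (Fin (n + 1))) (u : unitInterval) :
    stdSimplex.map f (simplexSegment s t u) =
      simplexSegment (stdSimplex.map f s) (stdSimplex.map f t) u := by
  ext j
  rw [simplexSegment_apply, stdSimplex_map_apply, stdSimplex_map_apply, stdSimplex_map_apply,
    Finset.mul_sum, Finset.mul_sum, ← Finset.sum_add_distrib]
  rfl

lemma continuous_coord (i : Fin (n + 1)) :
    Continuous fun t : stdSimplex ℝ (Fin (n + 1)) => t i :=
  (continuous_apply i).comp continuous_subtype_val

/-- The smallest coordinate of a point of a simplex. -/
noncomputable def minCoord (t : stdSimplex ℝ (Fin (n + 1))) : ℝ :=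
  Finset.univ.inf' Finset.univ_nonempty fun i => t i

lemma continuous_minCoord : Continuous (minCoord (n := n)) :=
  Continuous.finset_inf'_apply _ fun i _ => continuous_coord i

lemma minCoord_le (t : stdSimplex ℝ (Fin (n + 1))) (i : Fin (n + 1)) : minCoord t ≤ t i :=
  Finset.inf'_le _ (Finset.mem_univ i)

lemma exists_minCoord_eq (t : stdSimplex ℝ (Fin (n + 1))) : ∃ i, minCoord t = t i := by
  obtain ⟨i, -, hi⟩ := Finset.exists_mem_eq_inf' Finset.univ_nonempty fun i => t i
  exact ⟨i, hi⟩

/-- The amount by which `expand` lowers the coordinates before it rescales them. It is bounded away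
from the value `1 / (n + 1)` at the barycenter, where the rescaling is impossible. -/
noncomputable def lowering (t : stdSimplex ℝ (Fin (n + 1))) : ℝ :=
  min (minCoord t) (1 / (2 * (n + 1)))

lemma lowering_lt (t : stdSimplex ℝ (Fin (n + 1))) : (n + 1) * lowering t < 1 := by
  have h : (n + 1) * lowering t ≤ (n + 1) * (1 / (2 * (n + 1))) :=
    mul_le_mul_of_nonneg_left (min_le_right _ _) (by positivity)
  have h' : ((n : ℝ) + 1) * (1 / (2 * (n + 1))) = 1 / 2 := by field_simp
  linarith

/-- The self-map `t ↦ (t - c) / (1 - (n + 1) c)` of a simplex, with `c = lowering t`, which pushes the complement of a neighborhood of the barycenter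
radially onto the boundary, and fixes the boundary. -/
noncomputable def expand (t : stdSimplex ℝ (Fin (n + 1))) : stdSimplex ℝ (Fin (n + 1)) :=
  ⟨fun i => (t i - lowering t) / (1 - (n + 1) * lowering t), fun i =>
    div_nonneg (sub_nonneg.2 ((min_le_left _ _).trans (minCoord_le t i)))
      (sub_nonneg.2 (lowering_lt t).le), by
    rw [← Finset.sum_div, Finset.sum_sub_distrib, stdSimplex.sum_eq_one, Finset.sum_const,
      Finset.card_univ, Fintype.card_fin, nsmul_eq_mul, Nat.cast_add_one]
    exact div_self (sub_pos.2 (lowering_lt t)).ne'⟩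

lemma continuous_lowering : Continuous (lowering (n := n)) :=
  continuous_minCoord.min continuous_const

lemma continuous_expand : Continuous (expand (n := n)) := by
  refine Continuous.subtype_mk (continuous_pi fun i => ?_) _
  exact ((continuous_coord i).sub continuous_lowering).div
    (continuous_const.sub (continuous_const.mul continuous_lowering))
    fun t => (sub_pos.2 (lowering_lt t)).ne'

lemma expand_of_eq_zero {t : stdSimplex ℝ (Fin (n + 1))} {i : Fin (n + 1)} (hi : t i = 0) :
    expand t = t := by
  have h : lowering t = 0 := by
    obtain ⟨j, hj⟩ := exists_minCoord_eq t
    have h1 : minCoord t = 0 :=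
      le_antisymm ((minCoord_le t i).trans hi.le) (hj ▸ stdSimplex.zero_le t j)
    rw [lowering, h1, min_eq_left (by positivity)]
  ext j
  change (t j - lowering t) / (1 - (n + 1) * lowering t) = t j
  rw [h]
  ring

lemma exists_expand_eq_zero {t : stdSimplex ℝ (Fin (n + 1))}
    (ht : minCoord t < 1 / (2 * (n + 1))) : ∃ i, expand t i = 0 := by
  obtain ⟨i, hi⟩ := exists_minCoord_eq t
  refine ⟨i, ?_⟩
  change (t i - lowering t) / (1 - (n + 1) * lowering t) = 0
  rw [lowering, min_eq_left ht.le, hi, sub_self, zero_div]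

/-- The tracks of the straight homotopy from the identity of a simplex to `expand`. -/
noncomputable def expandTrack (t : stdSimplex ℝ (Fin (n + 1))) :
    Path t (expand t) := simplexSegment t (expand t)

lemma continuous_expandTrack :
    Continuous fun p : stdSimplex ℝ (Fin (n + 1)) × unitInterval => expandTrack p.1 p.2 := by
  refine Continuous.subtype_mk (continuous_pi fun i => ?_) _
  have h1 := (continuous_coord i).comp 
    (continuous_fst (X := stdSimplex ℝ (Fin (n + 1))) (Y := unitInterval))
  have h2 := (continuous_coord i).comp
    (continuous_expand.comp (continuous_fst (X := stdSimplex ℝ (Fin (n + 1))) (Y := unitInterval)))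
  have h3 := continuous_subtype_val.comp
    (continuous_snd (X := stdSimplex ℝ (Fin (n + 1))) (Y := unitInterval))
  exact ((continuous_const.sub h3).mul h1).add (h3.mul h2)

instance : ContractibleSpace (stdSimplex ℝ (Fin (n + 1))) :=
  (convex_stdSimplex ℝ _).contractibleSpace ⟨_, (stdSimplex.vertex 0).2⟩

end Segment

section PathClasses

variable {T : Type*} [TopologicalSpace T]

/-- A property of homotopy classes of paths which is closed under concatenation holds for the class
of a path if it holds for the classes of all sufficiently short subpaths. -/
lemma path_induction {P : ∀ a b : T, Path.Homotopic.Quotient a b → Prop}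
    (htrans : ∀ {a b c} (p : Path.Homotopic.Quotient a b) (q : Path.Homotopic.Quotient b c),
      P _ _ p → P _ _ q → P _ _ (p.trans q))
    {a b : T} (γ : Path a b) {ι : Type*} {U : ι → Set unitInterval}
    (hU : ∀ i, IsOpen (U i)) (hcov : ∀ s, ∃ i, s ∈ U i)
    (hloc : ∀ i s t, s ≤ t → Set.Icc s t ⊆ U i →
      P _ _ (Path.Homotopic.Quotient.mk (γ.subpath s t))) :
    P _ _ (Path.Homotopic.Quotient.mk γ) := by
  obtain ⟨t, h0, hmono, ⟨n, hn⟩, ht⟩ := exists_monotone_Icc_subset_open_cover_unitInterval hU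
    (fun s _ => Set.mem_iUnion.2 (hcov s))
  have key (k : ℕ) : P _ _ (Path.Homotopic.Quotient.mk (γ.subpath (t 0) (t k))) := by
    induction k with
    | zero =>
      obtain ⟨i, hi⟩ := ht 0
      exact hloc i _ _ le_rfl ((Set.Icc_subset_Icc_right (hmono (Nat.zero_le 1))).trans hi)
    | succ k ih =>
      obtain ⟨i, hi⟩ := ht k
      have h := htrans _ _ ih (hloc i _ _ (hmono k.le_succ) hi)
      rwa [← Path.Homotopic.Quotient.mk_trans, Path.Homotopic.Quotient.eq.2
        ⟨Path.Homotopy.subpathTransSubpath γ (t 0) (t k) (t (k + 1))⟩] at h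
  have h := key n
  rw [h0, hn n le_rfl, Path.subpath_zero_one] at h
  have hcast {a' b' : T} (ha : a' = a) (hb : b' = b)
      (h : P _ _ (Path.Homotopic.Quotient.mk (γ.cast ha hb))) :
      P _ _ (Path.Homotopic.Quotient.mk γ) := by
    subst ha hb
    exact h
  exact hcast _ _ h

lemma path_congr {P : ∀ a b : T, Path.Homotopic.Quotient a b → Prop} {a b a' b' : T}
    {γ : Path a b} {γ' : Path a' b'} (h : ∀ u, γ u = γ' u)
    (hP : P _ _ (Path.Homotopic.Quotient.mk γ)) : P _ _ (Path.Homotopic.Quotient.mk γ') := by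
  obtain rfl : a = a' := by rw [← γ.source, ← γ'.source, h]
  obtain rfl : b = b' := by rw [← γ.target, ← γ'.target, h]
  obtain rfl : γ = γ' := Path.ext (funext h)
  exact hP

/-- The boundary of a square gives a relation between the classes of its four sides. -/
lemma mk_eq_of_square (K : C(unitInterval × unitInterval, T)) {a b a' b' : T}
    {γ : Path a b} {γ' : Path a' b'}
    {α : Path a a'} {β : Path b b'} (hγ : ∀ s, K (s, 0) = γ s) (hγ' : ∀ s, K (s, 1) = γ' s)
    (hα : ∀ u, K (0, u) = α u) (hβ : ∀ u, K (1, u) = β u) :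
    Path.Homotopic.Quotient.mk γ =
      ((Path.Homotopic.Quotient.mk α).trans (Path.Homotopic.Quotient.mk γ')).trans
        (Path.Homotopic.Quotient.mk β.symm) := by
  let f : C(ℝ × ℝ, T) := K.comp ⟨fun p => (Set.projIcc 0 1 zero_le_one p.1,
    Set.projIcc 0 1 zero_le_one p.2), by fun_prop⟩
  have hf (s u : unitInterval) : f ((s : ℝ), (u : ℝ)) = K (s, u) := by simp [f]
  let p (x y : ℝ × ℝ) : Path x y := Path.segment x y
  have h00 : a = f (0, 0) := by
    rw [← γ.source, ← hγ]; exact (hf 0 0).symm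
  have h10 : b = f (1, 0) := by
    rw [← γ.target, ← hγ]; exact (hf 1 0).symm
  have h01 : a' = f (0, 1) := by
    rw [← γ'.source, ← hγ']; exact (hf 0 1).symm
  have h11 : b' = f (1, 1) := by
    rw [← γ'.target, ← hγ']; exact (hf 1 1).symm
  subst h00 h10 h01 h11
  obtain rfl : γ = (p (0, 0) (1, 0)).map f.continuous := by
    ext s
    rw [← hγ, ← hf]
    simp [p, AffineMap.lineMap_apply]
  obtain rfl : γ' = (p (0, 1) (1, 1)).map f.continuous := by
    ext s
    rw [← hγ', ← hf]
    simp [p, AffineMap.lineMap_apply]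
  obtain rfl : α = (p (0, 0) (0, 1)).map f.continuous := by
    ext s
    rw [← hα, ← hf]
    simp [p, AffineMap.lineMap_apply]
  obtain rfl : β = (p (1, 0) (1, 1)).map f.continuous := by
    ext s
    rw [← hβ, ← hf]
    simp [p, AffineMap.lineMap_apply]
  rw [← Path.Homotopic.Quotient.mk_trans, ← Path.Homotopic.Quotient.mk_trans, Path.map_symm,
    ← Path.map_trans, ← Path.map_trans, Path.Homotopic.Quotient.eq]
  exact (SimplyConnectedSpace.paths_homotopic _ _).map f

end PathClasses

end QuasiExact

/-! ### Paths in a geometric realization are concatenations of paths in cells -/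

namespace QuasiExact

section PathsInRealization

variable {X : SSet.{u}}

/-- A nondegenerate simplex of dimension at most `n` passes through the interior of an
`n`-dimensional one only if they coincide, and then at the same point. -/
lemma eq_of_normalForm_cell_eq {m n : ℕ} (hmn : m ≤ n) {ρ : X.nonDegenerate m}
    {t : stdSimplex ℝ (Fin (m + 1))} {σ : X.nonDegenerate n} {s : stdSimplex ℝ (Fin (n + 1))}
    (h : normalForm (cell ρ.1 t) = ⟨n, σ, s⟩) : (⟨m, ρ, t⟩ : CellPoint X) = ⟨n, σ, s⟩ := by
  have hd : cellDim (cell ρ.1 t) = n := by rw [cellDim, h]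
  have ht : ∀ i, 0 < t i := by
    intro i
    by_contra hi
    have := cellDim_cell_lt ρ.1 (le_antisymm (not_lt.1 hi) (stdSimplex.zero_le t i))
    omega
  rw [← h, normalForm_cell ρ ht]

/-- The points in the interior of a nondegenerate simplex. -/
def openCell {n : ℕ} (σ : X.nonDegenerate n) : Set (SSet.toTop.obj X) :=
  {y | ∃ s, normalForm y = ⟨n, σ, s⟩}

open Classical in
/-- The coordinates of a point in the interior of a nondegenerate simplex (and an irrelevant value
at all other points). -/
noncomputable def cellCoord {n : ℕ} (σ : X.nonDegenerate n) (y : SSet.toTop.obj X) :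
    stdSimplex ℝ (Fin (n + 1)) :=
  if h : y ∈ openCell σ then h.choose else stdSimplex.vertex 0

lemma normalForm_eq_cellCoord {n : ℕ} {σ : X.nonDegenerate n} {y : SSet.toTop.obj X}
    (h : y ∈ openCell σ) : normalForm y = ⟨n, σ, cellCoord σ y⟩ := by
  rw [cellCoord, dif_pos h]
  exact h.choose_spec

lemma cellCoord_eq {n : ℕ} {σ : X.nonDegenerate n} {y : SSet.toTop.obj X}
    {s : stdSimplex ℝ (Fin (n + 1))} (h : normalForm y = ⟨n, σ, s⟩) : cellCoord σ y = s := by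
  have := (normalForm_eq_cellCoord ⟨s, h⟩).symm.trans h
  simpa using this

/-- Inside the `n`-skeleton, the interior of an `n`-dimensional simplex is open. -/
lemma isClosed_notMem_openCell {n : ℕ} (σ : X.nonDegenerate n) :
    IsClosed ({y | cellDim y ≤ n ∧ y ∉ openCell σ} : Set (SSet.toTop.obj X)) := by
  refine isClosed_of_nonDegenerate (fun m ρ => {t | m ≤ n ∧
    (⟨m, ρ⟩ : Σ m, X.nonDegenerate m) ≠ ⟨n, σ⟩}) (fun m ρ => isClosed_const) ?_ ?_
  · rintro m ρ t ht ⟨h1, h2⟩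
    rw [cellDim_cell_of_pos ρ ht] at h1
    refine ⟨h1, fun h => h2 ?_⟩
    obtain ⟨rfl, h⟩ := Sigma.mk.inj_iff.1 h
    obtain rfl := eq_of_heq h
    exact ⟨t, normalForm_cell ρ ht⟩
  · rintro m ρ t ⟨h1, h2⟩
    refine ⟨(cellDim_cell_le _ _).trans h1, ?_⟩
    rintro ⟨s, hs⟩
    have h := eq_of_normalForm_cell_eq h1 hs
    obtain ⟨rfl, h⟩ := Sigma.mk.inj_iff.1 h
    exact h2 (by rw [(Prod.mk.inj (eq_of_heq h)).1])

lemma continuousOn_cellCoord {n : ℕ} (σ : X.nonDegenerate n) :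
    ContinuousOn (cellCoord σ) (openCell σ) := by
  rw [continuousOn_iff_isClosed]
  intro F hF
  refine ⟨{y | cellDim y ≤ n ∧ (y ∈ openCell σ → cellCoord σ y ∈ F)}, ?_, ?_⟩
  · refine isClosed_of_nonDegenerate (fun m ρ => {t | m ≤ n ∧
      ∀ s, (⟨m, ρ, t⟩ : CellPoint X) = ⟨n, σ, s⟩ → s ∈ F}) (fun m ρ => ?_) ?_ ?_
    · by_cases h : (⟨m, ρ⟩ : Σ m, X.nonDegenerate m) = ⟨n, σ⟩
      · obtain ⟨rfl, h⟩ := Sigma.mk.inj_iff.1 h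
        obtain rfl := eq_of_heq h
        convert hF using 1
        ext t
        simp
      · have hu : {t | m ≤ n ∧ ∀ s, (⟨m, ρ, t⟩ : CellPoint X) = ⟨n, σ, s⟩ → s ∈ F} =
            {t | m ≤ n} := by
          ext t
          refine and_iff_left fun s hs => absurd ?_ h
          obtain ⟨rfl, hs⟩ := Sigma.mk.inj_iff.1 hs
          rw [(Prod.mk.inj (eq_of_heq hs)).1]
        rw [hu]
        exact isClosed_const
    · rintro m ρ t ht ⟨h1, h2⟩
      rw [cellDim_cell_of_pos ρ ht] at h1
      refine ⟨h1, fun s hs => ?_⟩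
      have h := (normalForm_cell ρ ht).trans hs
      rw [← cellCoord_eq h]
      exact h2 ⟨s, h⟩
    · rintro m ρ t ⟨h1, h2⟩
      refine ⟨(cellDim_cell_le _ _).trans h1, ?_⟩
      rintro ⟨s, hs⟩
      rw [cellCoord_eq hs]
      exact h2 s (eq_of_normalForm_cell_eq h1 hs)
  · ext y
    constructor
    · rintro ⟨h1, s, hs⟩
      exact ⟨⟨by rw [cellDim, hs], fun _ => h1⟩, s, hs⟩
    · rintro ⟨⟨-, h1⟩, h2⟩
      exact ⟨h1 h2, h2⟩

/-- The points which the expansion of the `n`-dimensional simplices need not move to the skeleton of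
dimension `n - 1`. -/
def core (X : SSet.{u}) (n : ℕ) : Set (SSet.toTop.obj X) :=
  {y | cellDim y = n ∧ 1 / (2 * (n + 1)) ≤ minCoord (normalForm y).2.2}

lemma isClosed_core (n : ℕ) : IsClosed (core X n) := by
  refine isClosed_of_nonDegenerate (fun m ρ => {t | m = n ∧ 1 / (2 * (n + 1)) ≤ minCoord t})
    (fun m ρ => IsClosed.inter isClosed_const (isClosed_le continuous_const continuous_minCoord))
    ?_ ?_
  · rintro m ρ t ht ⟨h1, h2⟩
    rw [cellDim_cell_of_pos ρ ht] at h1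
    rw [normalForm_cell ρ ht] at h2
    exact ⟨h1, h2⟩
  · rintro m ρ t ⟨h1, h2⟩
    have ht : ∀ i, 0 < t i := fun i => lt_of_lt_of_le (by positivity) (h2.trans (minCoord_le t i))
    refine ⟨(cellDim_cell_of_pos ρ ht).trans h1, ?_⟩
    rwa [normalForm_cell ρ ht]

/-- The track of the expansion of a nondegenerate simplex at one of its points. -/
noncomputable def expandAt (N : CellPoint X) : C(unitInterval, SSet.toTop.obj X) :=
  (cell N.2.1.1).comp (expandTrack N.2.2)

open Classical in
/-- The tracks of the homotopy which expands the `n`-dimensional simplices and fixes all others. -/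
noncomputable def expandCells (n : ℕ) (y : SSet.toTop.obj X) : C(unitInterval, SSet.toTop.obj X) :=
  if cellDim y = n then expandAt (normalForm y) else ContinuousMap.const _ y

lemma expandCells_cell_of_lt {m n : ℕ} (h : m < n) (σ : X _⦋m⦌) (t : stdSimplex ℝ (Fin (m + 1))) :
    expandCells n (cell σ t) = ContinuousMap.const _ (cell σ t) := by
  rw [expandCells, if_neg]
  exact ((cellDim_cell_le σ t).trans_lt h).ne

lemma expandCells_cell {n : ℕ} (σ : X.nonDegenerate n) (t : stdSimplex ℝ (Fin (n + 1))) :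
    expandCells n (cell σ.1 t) = (cell σ.1).comp (expandTrack t) := by
  by_cases ht : ∀ i, 0 < t i
  · rw [expandCells, if_pos (cellDim_cell_of_pos σ ht), normalForm_cell σ ht]
    rfl
  · push Not at ht
    obtain ⟨i, hi⟩ := ht
    have h0 := le_antisymm hi (stdSimplex.zero_le t i)
    rw [expandCells, if_neg (cellDim_cell_lt σ.1 h0).ne]
    ext u
    have : expandTrack t u = t := by
      have h : ∀ t', t' = t → simplexSegment t t' u = t := by
        rintro _ rfl
        exact simplexSegment_self _ u
      exact h _ (expand_of_eq_zero h0)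
    exact (congrArg (cell σ.1) this).symm

lemma expandCells_apply_one {n : ℕ} {σ : X.nonDegenerate n} {y : SSet.toTop.obj X}
    (h : y ∈ openCell σ) : expandCells n y 1 = cell σ.1 (expand (cellCoord σ y)) := by
  have h1 := normalForm_eq_cellCoord h
  have h2 := cell_normalForm y
  rw [h1] at h2
  conv_lhs => rw [← h2]
  rw [expandCells_cell]
  change cell _ (expandTrack _ 1) = _
  rw [Path.target]

lemma cellDim_expandCells_lt {n : ℕ} {y : SSet.toTop.obj X} (hy : cellDim y ≤ n)
    (h : y ∉ core X n) : cellDim (expandCells n y 1) < n := by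
  obtain hlt | rfl := hy.lt_or_eq
  · rw [expandCells, if_neg hlt.ne]
    exact hlt
  · obtain ⟨i, hi⟩ := exists_expand_eq_zero (not_le.1 fun h' => h ⟨rfl, h'⟩)
    rw [expandCells, if_pos rfl]
    change cellDim (cell _ (expandTrack _ 1)) < _
    rw [Path.target]
    exact cellDim_cell_lt _ hi

lemma continuousOn_expandCells (n : ℕ) :
    ContinuousOn (expandCells (X := X) n) {y | cellDim y ≤ n} := by
  rw [continuousOn_iff_isClosed]
  intro F hF
  refine ⟨{y | cellDim y ≤ n ∧ expandCells n y ∈ F}, ?_, ?_⟩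
  · refine isClosed_of_nonDegenerate (fun m ρ => {t | m ≤ n ∧ expandCells n (cell ρ.1 t) ∈ F})
      (fun m ρ => ?_) ?_ ?_
    · rcases lt_trichotomy m n with h | rfl | h
      · refine IsClosed.inter isClosed_const (hF.preimage ?_)
        simp_rw [expandCells_cell_of_lt h]
        exact ContinuousMap.continuous_const'.comp (cell ρ.1).continuous
      · refine IsClosed.inter isClosed_const (hF.preimage ?_)
        simp_rw [expandCells_cell]
        exact ContinuousMap.continuous_of_continuous_uncurry _
          ((cell ρ.1).continuous.comp continuous_expandTrack)
      · simp [h.not_ge]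
    · rintro m ρ t ht ⟨h1, h2⟩
      rw [cellDim_cell_of_pos ρ ht] at h1
      exact ⟨h1, h2⟩
    · rintro m ρ t ⟨h1, h2⟩
      exact ⟨(cellDim_cell_le _ _).trans h1, h2⟩
  · ext y
    simp only [Set.mem_inter_iff, Set.mem_preimage, Set.mem_ofPred_eq]
    tauto

/-- A compact interval in a geometric realization meets the interiors of simplices of bounded
dimension only, since a set with finitely many points in each dimension is closed. -/
lemma exists_forall_cellDim_lt (γ : C(unitInterval, SSet.toTop.obj X)) :
    ∃ n, ∀ s, cellDim (γ s) < n := by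
  by_contra! h
  choose s hs using h
  let F (k : ℕ) : Set (SSet.toTop.obj X) := {y | ∃ j, k ≤ j ∧ γ (s j) = y}
  have hF (k : ℕ) : IsClosed (F k) := by
    refine isClosed_of_nonDegenerate
      (fun m ρ => {t | ∃ j, k ≤ j ∧ normalForm (γ (s j)) = ⟨m, ρ, t⟩}) (fun m ρ => ?_) ?_ ?_
    · refine Set.Finite.isClosed (Set.Finite.subset
        ((Set.finite_Iic m).image fun j => cellCoord ρ (γ (s j))) ?_)
      rintro t ⟨j, -, hj⟩
      refine ⟨j, ?_, cellCoord_eq hj⟩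
      have := hs j
      rw [cellDim, hj] at this
      exact this
    · rintro m ρ t ht ⟨j, hj, h⟩
      exact ⟨j, hj, by rw [h, normalForm_cell ρ ht]⟩
    · rintro m ρ t ⟨j, hj, h⟩
      refine ⟨j, hj, ?_⟩
      rw [← cell_normalForm (γ (s j)), h]
  have hcl (k : ℕ) : IsClosed (γ ⁻¹' F k) := (hF k).preimage γ.continuous
  obtain ⟨x, hx⟩ := IsCompact.nonempty_iInter_of_sequence_nonempty_isCompact_isClosed
    (fun k => γ ⁻¹' F k)
    (fun k y => fun ⟨j, hj, h⟩ => ⟨j, k.le_succ.trans hj, h⟩) (fun k => ⟨s k, k, le_rfl, rfl⟩)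
    (hcl 0).isCompact hcl
  obtain ⟨j, hj, h⟩ := Set.mem_iInter.1 hx (cellDim (γ x) + 1)
  have := hs j
  rw [h] at this
  omega

variable {P : ∀ a b : SSet.toTop.obj X, Path.Homotopic.Quotient a b → Prop}

/-- A property of homotopy classes of paths in a geometric realization which is closed under
concatenation, and holds for the paths inside simplices, holds for all paths. -/
theorem path_induction_realization
    (htrans : ∀ {a b c} (p : Path.Homotopic.Quotient a b) (q : Path.Homotopic.Quotient b c),
      P _ _ p → P _ _ q → P _ _ (p.trans q))
    (hcell : ∀ {n : ℕ} (σ : X _⦋n⦌) {s t : stdSimplex ℝ (Fin (n + 1))} (α : Path s t),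
      P _ _ (Path.Homotopic.Quotient.mk (α.map (cell σ).continuous)))
    {a b : SSet.toTop.obj X} (p : Path.Homotopic.Quotient a b) : P _ _ p := by
  obtain ⟨γ, rfl⟩ := Path.Homotopic.Quotient.mk_surjective p
  -- Induction on the dimension of a skeleton which contains the path. The expansion of the simplices
  -- of top dimension moves the path to a path `γ'`, and a short piece of `γ'` lies in the next lower
  -- skeleton, or it comes from a piece of `γ` inside the interior of one simplex.
  obtain ⟨n, hn⟩ := exists_forall_cellDim_lt γ.toContinuousMap
  replace hn : ∀ s, cellDim (γ s) < n := hn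
  induction n generalizing a b with
  | zero => exact absurd (hn 0) (Nat.not_lt_zero _)
  | succ n ih =>
    have hK : Continuous fun p : unitInterval × unitInterval => expandCells n (γ p.1) p.2 :=
      (((continuousOn_expandCells n).comp_continuous γ.continuous
        fun s => Nat.le_of_lt_succ (hn s)).comp continuous_fst).eval continuous_snd
    have hK0 (y : SSet.toTop.obj X) : expandCells n y 0 = y := by
      rw [expandCells]
      split_ifs
      · change cell _ (expandTrack _ 0) = y
        rw [Path.source, cell_normalForm]
      · rfl
    have htrack (y : SSet.toTop.obj X) :
        P _ _ (Path.Homotopic.Quotient.mk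
          (⟨expandCells n y, hK0 y, rfl⟩ : Path y (expandCells n y 1))) ∧
        P _ _ (Path.Homotopic.Quotient.mk
          (⟨expandCells n y, hK0 y, rfl⟩ : Path y (expandCells n y 1)).symm) := by
      by_cases h : cellDim y = n
      · constructor
        · refine path_congr (fun u => ?_)
            (hcell (normalForm y).2.1.1 (expandTrack (normalForm y).2.2))
          change _ = expandCells n y u
          rw [expandCells, if_pos h]
          rfl
        · refine path_congr (fun u => ?_)
            (hcell (normalForm y).2.1.1 (expandTrack (normalForm y).2.2).symm)
          change _ = expandCells n y (unitInterval.symm u)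
          rw [expandCells, if_pos h]
          rfl
      · constructor
        · refine path_congr (fun u => ?_)
            (hcell (normalForm y).2.1.1 (Path.refl (normalForm y).2.2))
          change cell _ _ = expandCells n y u
          rw [expandCells, if_neg h]
          exact cell_normalForm y
        · refine path_congr (fun u => ?_)
            (hcell (normalForm y).2.1.1 (Path.refl (normalForm y).2.2))
          change cell _ _ = expandCells n y (unitInterval.symm u)
          rw [expandCells, if_neg h]
          exact cell_normalForm y
    let γ' : Path (expandCells n a 1) (expandCells n b 1) :=
      { toFun s := expandCells n (γ s) 1
        continuous_toFun := hK.comp (continuous_id.prodMk continuous_const)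
        source' := by rw [γ.source]
        target' := by rw [γ.target] }
    rw [mk_eq_of_square ⟨_, hK⟩ (γ := γ) (γ' := γ')
      (α := ⟨expandCells n a, hK0 a, rfl⟩) (β := ⟨expandCells n b, hK0 b, rfl⟩)
      (fun s => hK0 (γ s)) (fun s => rfl)
      (fun u => by simp) (fun u => by simp)]
    refine htrans _ _ (htrans _ _ (htrack a).1 ?_) (htrack b).2
    refine path_induction htrans γ' (ι := Option (X.nonDegenerate n))
      (U := fun i => i.elim (γ ⁻¹' (core X n)ᶜ) fun σ =>
        γ ⁻¹' {y | cellDim y ≤ n ∧ y ∉ openCell σ}ᶜ)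
      ?_ ?_ ?_
    · rintro (_ | σ)
      · exact (isClosed_core n).isOpen_compl.preimage γ.continuous
      · exact (isClosed_notMem_openCell σ).isOpen_compl.preimage γ.continuous
    · intro s
      by_cases hs : γ s ∈ core X n
      · rcases hN : normalForm (γ s) with ⟨m, ρ, t⟩
        obtain rfl : m = n := by rw [← hs.1, cellDim, hN]
        exact ⟨some ρ, fun h => h.2 ⟨t, hN⟩⟩
      · exact ⟨none, hs⟩
    · rintro i s t hst hU
      have hmem (u : unitInterval) : Set.Icc.convexComb s t u ∈ Set.Icc s t := by
        rw [← Set.uIcc_of_le hst, ← Path.range_subpathAux]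
        exact ⟨u, rfl⟩
      have hle (u : unitInterval) : cellDim (γ u) ≤ n := Nat.le_of_lt_succ (hn u)
      rcases i with _ | σ
      · exact ih _ fun u => cellDim_expandCells_lt (hle _) (hU (hmem u))
      · have hopen (u : unitInterval) : γ (Set.Icc.convexComb s t u) ∈ openCell σ := by
          by_contra h
          exact hU (hmem u) ⟨hle _, h⟩
        let q : C(unitInterval, stdSimplex ℝ (Fin (n + 1))) :=
          ⟨fun u => expand (cellCoord σ (γ.subpath s t u)), continuous_expand.comp
            ((continuousOn_cellCoord σ).comp_continuous (γ.subpath s t).continuous hopen)⟩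
        exact path_congr (fun u => (expandCells_apply_one (hopen u)).symm)
          (hcell σ.1 (⟨q, rfl, rfl⟩ : Path (q 0) (q 1)))

end PathsInRealization

end QuasiExact

/-! ### Paths between vertices of a classifying space are concatenations of edges -/

namespace QuasiExact

section EdgePaths

variable {D : Type u} [Category.{v} D]

/-- The objects of a string of composable morphisms. -/
def nerveObj {n : ℕ} (σ : nerve D _⦋n⦌) (i : Fin (n + 1)) : D :=
  Functor.obj (C := Fin (n + 1)) (D := D) σ i

/-- The composites in a string of composable morphisms. -/
def nerveHom {n : ℕ} (σ : nerve D _⦋n⦌) {i j : Fin (n + 1)} (h : i ≤ j) :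
    nerveObj σ i ⟶ nerveObj σ j :=
  CategoryTheory.Functor.map (C := Fin (n + 1)) (D := D) σ (homOfLE h)

/-- An object as a vertex of the nerve. -/
def nerveVertex (x : D) : nerve D _⦋0⦌ := ComposableArrows.mk₀ x

/-- A morphism as an edge of the nerve. -/
def nerveEdge {x y : D} (f : x ⟶ y) : nerve D _⦋1⦌ := ComposableArrows.mk₁ f

lemma map_const_eq_nerveVertex {n : ℕ} (σ : nerve D _⦋n⦌) (i : Fin (n + 1)) :
    (nerve D).map (SimplexCategory.const ⦋0⦌ ⦋n⦌ i).op σ = nerveVertex (nerveObj σ i) :=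
  ComposableArrows.ext₀ rfl

lemma map_mkOfLe_eq_nerveEdge {n : ℕ} (σ : nerve D _⦋n⦌) {i j : Fin (n + 1)} (h : i ≤ j) :
    (nerve D).map (SimplexCategory.mkOfLe i j h).op σ = nerveEdge (nerveHom σ h) := by
  refine ComposableArrows.ext₁ rfl rfl ?_
  change nerveHom σ h = 𝟙 _ ≫ nerveHom σ h ≫ 𝟙 _
  rw [Category.id_comp, Category.comp_id]

lemma cell_nerveVertex (x : D) (t : stdSimplex ℝ (Fin 1)) :
    cell (nerveVertex x) t = point x := by
  obtain rfl : t = default := Subsingleton.elim _ _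
  rfl

lemma cell_vertex {n : ℕ} (σ : nerve D _⦋n⦌) (i : Fin (n + 1)) :
    cell σ (stdSimplex.vertex i) = point (nerveObj σ i) := by
  rw [← cell_nerveVertex (nerveObj σ i) (stdSimplex.vertex 0), ← map_const_eq_nerveVertex, cell_map,
    stdSimplex.map_vertex]
  rfl

lemma edgePath_apply {x y : D} (f : x ⟶ y) (u : unitInterval) :
    edgePath f u = cell (nerveEdge f)
      (simplexSegment (stdSimplex.vertex 0) (stdSimplex.vertex 1) u) := by
  have h : simplexSegment (stdSimplex.vertex 0) (stdSimplex.vertex 1) u =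
      TopCat.stdSimplexHomeomorphI.{max u v}.symm (ULift.up u) := by
    ext i
    rw [simplexSegment_apply]
    fin_cases i
    · change (1 - (u : ℝ)) * (Pi.single 0 1 : Fin 2 → ℝ) 0 + u * (Pi.single 1 1 : Fin 2 → ℝ) 0 =
        1 - u
      simp
    · change (1 - (u : ℝ)) * (Pi.single 0 1 : Fin 2 → ℝ) 1 + u * (Pi.single 1 1 : Fin 2 → ℝ) 1 = u
      simp
  rw [h]
  rfl

lemma edgePath_nerveHom {n : ℕ} (σ : nerve D _⦋n⦌) {i j : Fin (n + 1)} (h : i ≤ j)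
    (u : unitInterval) :
    edgePath (nerveHom σ h) u =
      cell σ (simplexSegment (stdSimplex.vertex i) (stdSimplex.vertex j) u) := by
  rw [edgePath_apply, ← map_mkOfLe_eq_nerveEdge, cell_map, map_simplexSegment,
    stdSimplex.map_vertex, stdSimplex.map_vertex]
  rfl

/-- A property of the classes of paths between vertices which holds for all concatenations of edges
of the nerve, run through in either direction. -/
structure EdgeClosed (P : ∀ ⦃x y : D⦄, Path.Homotopic.Quotient (point x) (point y) → Prop) :
    Prop where
  refl (x : D) : P (Path.Homotopic.Quotient.refl (point x))
  edge {x y : D} (f : x ⟶ y) : P (Path.Homotopic.Quotient.mk (edgePath f))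
  symm {x y : D} {p : Path.Homotopic.Quotient (point x) (point y)} : P p → P p.symm
  trans {x y z : D} {p : Path.Homotopic.Quotient (point x) (point y)}
    {q : Path.Homotopic.Quotient (point y) (point z)} : P p → P q → P (p.trans q)

variable {P : ∀ ⦃x y : D⦄, Path.Homotopic.Quotient (point x) (point y) → Prop}

/-- The straight path from the first vertex of a simplex to one of its points. -/
noncomputable def vertexPath {n : ℕ} (σ : nerve D _⦋n⦌) (t : stdSimplex ℝ (Fin (n + 1)))
    {a : ClassifyingSpace D} (h : cell σ t = a) : Path (point (nerveObj σ 0)) a :=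
  ((simplexSegment (stdSimplex.vertex 0) t).map (cell σ).continuous).cast
    (cell_vertex σ 0).symm h.symm

/-- The class of `vertexPath`. -/
noncomputable def vertexClass {n : ℕ} (σ : nerve D _⦋n⦌) (t : stdSimplex ℝ (Fin (n + 1)))
    {a : ClassifyingSpace D} (h : cell σ t = a) :
    Path.Homotopic.Quotient (point (nerveObj σ 0)) a :=
  Path.Homotopic.Quotient.mk (vertexPath σ t h)

lemma symm_trans_cancel {T : Type*} [TopologicalSpace T] {a b c : T}
    (p : Path.Homotopic.Quotient a b) (q : Path.Homotopic.Quotient b c) :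
    p.symm.trans (p.trans q) = q := by
  rw [← Path.Homotopic.Quotient.trans_assoc, Path.Homotopic.Quotient.symm_trans,
    Path.Homotopic.Quotient.refl_trans]

/-- Paths inside a simplex compose up to homotopy, since the simplex is simply connected. -/
lemma mk_eq_trans_of_simplex {X : SSet.{u}} {n : ℕ} (σ : X _⦋n⦌)
    {r s t : stdSimplex ℝ (Fin (n + 1))} (α : Path r s) (β : Path s t) (γ : Path r t)
    {a b c : SSet.toTop.obj X} {α' : Path a b} {β' : Path b c} {γ' : Path a c}
    (hα : ∀ u, α' u = cell σ (α u)) (hβ : ∀ u, β' u = cell σ (β u))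
    (hγ : ∀ u, γ' u = cell σ (γ u)) :
    Path.Homotopic.Quotient.mk γ' =
      (Path.Homotopic.Quotient.mk α').trans (Path.Homotopic.Quotient.mk β') := by
  obtain rfl : a = cell σ r := by rw [← α'.source, hα, α.source]
  obtain rfl : b = cell σ s := by rw [← α'.target, hα, α.target]
  obtain rfl : c = cell σ t := by rw [← β'.target, hβ, β.target]
  obtain rfl : α' = α.map (cell σ).continuous := Path.ext (funext hα)
  obtain rfl : β' = β.map (cell σ).continuous := Path.ext (funext hβ)
  obtain rfl : γ' = γ.map (cell σ).continuous := Path.ext (funext hγ)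
  rw [← Path.Homotopic.Quotient.mk_trans, ← Path.map_trans]
  exact Path.Homotopic.Quotient.eq.2 ((SimplyConnectedSpace.paths_homotopic _ _).map _)

/-- The straight path from the first vertex of a simplex to a point of a face is the composite of an
edge and of the straight path in the face. -/
lemma vertexClass_map {m n : ℕ} (θ : ⦋m⦌ ⟶ ⦋n⦌) (σ : nerve D _⦋n⦌)
    (t : stdSimplex ℝ (Fin (m + 1))) {a : ClassifyingSpace D}
    (h : cell σ (stdSimplex.map θ t) = a) (h' : cell ((nerve D).map θ.op σ) t = a) :
    vertexClass σ (stdSimplex.map θ t) h =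
      Path.Homotopic.Quotient.trans
        (Path.Homotopic.Quotient.mk (edgePath (nerveHom σ (Fin.zero_le (θ 0)))))
        (vertexClass ((nerve D).map θ.op σ) t h') := by
  refine mk_eq_trans_of_simplex σ (simplexSegment (stdSimplex.vertex 0) (stdSimplex.vertex (θ 0)))
    (simplexSegment (stdSimplex.vertex (θ 0)) (stdSimplex.map θ t))
    (simplexSegment (stdSimplex.vertex 0) (stdSimplex.map θ t))
    (edgePath_nerveHom σ _) (fun u => ?_) fun u => rfl
  refine (cell_map θ σ _).trans ?_
  rw [map_simplexSegment, stdSimplex.map_vertex]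

lemma vertexClass_map_trans {m n : ℕ} (θ : ⦋m⦌ ⟶ ⦋n⦌) (σ : nerve D _⦋n⦌)
    (t : stdSimplex ℝ (Fin (m + 1))) {a b : ClassifyingSpace D}
    (h : cell σ (stdSimplex.map θ t) = a) (h' : cell ((nerve D).map θ.op σ) t = a)
    (q : Path.Homotopic.Quotient a b) :
    (vertexClass σ (stdSimplex.map θ t) h).trans q =
      Path.Homotopic.Quotient.trans
        (Path.Homotopic.Quotient.mk (edgePath (nerveHom σ (Fin.zero_le (θ 0)))))
        (Path.Homotopic.Quotient.trans (vertexClass ((nerve D).map θ.op σ) t h') q) :=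
  (congrArg (fun r => Path.Homotopic.Quotient.trans r q) (vertexClass_map θ σ t h h')).trans
    (Path.Homotopic.Quotient.trans_assoc _ _ _)

/-- The straight paths to a point from the first vertex of a simplex, and from the first vertex of the
nondegenerate simplex which has the point in its interior, differ by edges only. -/
lemma EdgeClosed.vertexClass_normalForm (hP : EdgeClosed P) {n : ℕ} (σ : nerve D _⦋n⦌)
    (t : stdSimplex ℝ (Fin (n + 1))) {a : ClassifyingSpace D} (h : cell σ t = a) :
    P ((vertexClass σ t h).trans
      (vertexClass (normalForm a).2.1.1 (normalForm a).2.2 (cell_normalForm a)).symm) := by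
  refine simplexPoint_induction (X := nerve D) (P := fun n σ t =>
    ∀ (a : ClassifyingSpace D) (h : cell σ t = a),
      P ((vertexClass σ t h).trans
        (vertexClass (normalForm a).2.1.1 (normalForm a).2.2 (cell_normalForm a)).symm))
    ?_ ?_ ?_ n σ t a h
  · rintro n σ t ht _ rfl
    have key : ∀ (N : CellPoint (nerve D)) (hN : cell N.2.1.1 N.2.2 = cell σ.1 t),
        N = ⟨n, σ, t⟩ →
        P ((vertexClass σ.1 t rfl).trans (vertexClass N.2.1.1 N.2.2 hN).symm) := by
      rintro _ hN rfl
      rw [Path.Homotopic.Quotient.trans_symm]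
      exact hP.refl _
    exact key _ _ (normalForm_cell σ ht)
  · intro n i σ t ih a h
    have h' := (cell_map (SimplexCategory.δ i) σ t).trans h
    rw [vertexClass_map_trans (SimplexCategory.δ i) σ t h h']
    exact hP.trans (hP.edge _) (ih a h')
  · intro n i σ t ih a h
    have h' := (cell_map (SimplexCategory.σ i) σ t).symm.trans h
    have := ih a h'
    rw [vertexClass_map_trans (SimplexCategory.σ i) σ t h' h] at this
    have h2 := hP.trans (hP.symm (hP.edge (nerveHom σ (Fin.zero_le (SimplexCategory.σ i 0))))) this
    exact Eq.mp (congrArg (@P _ _) (symm_trans_cancel _ _)) h2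

lemma symm_trans_eq {T : Type*} [TopologicalSpace T] {a b c : T}
    (p : Path.Homotopic.Quotient a b) (q : Path.Homotopic.Quotient c b) :
    (p.trans q.symm).symm = q.trans p.symm := by
  have h := symm_trans_cancel (p.trans q.symm) (q.trans p.symm)
  rw [Path.Homotopic.Quotient.trans_assoc, symm_trans_cancel,
    Path.Homotopic.Quotient.trans_symm, Path.Homotopic.Quotient.trans_refl] at h
  exact h

/-- Straight paths from first vertices to the same point differ by edges only. -/
lemma EdgeClosed.vertexClass_vertexClass (hP : EdgeClosed P) {m n : ℕ} (σ : nerve D _⦋n⦌)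
    (t : stdSimplex ℝ (Fin (n + 1)))
    (τ : nerve D _⦋m⦌) (s : stdSimplex ℝ (Fin (m + 1)))
    {a : ClassifyingSpace D} (h : cell σ t = a) (h' : cell τ s = a) :
    P ((vertexClass σ t h).trans (vertexClass τ s h').symm) := by
  have h1 := hP.trans (hP.vertexClass_normalForm σ t h)
    (hP.symm (hP.vertexClass_normalForm τ s h'))
  rwa [symm_trans_eq, Path.Homotopic.Quotient.trans_assoc, symm_trans_cancel] at h1

lemma vertexClass_nerveVertex (x : D) :
    vertexClass (nerveVertex x) default (a := point x) rfl =
      Path.Homotopic.Quotient.refl (point x) := by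
  refine congrArg Path.Homotopic.Quotient.mk (Path.ext (funext fun u => ?_))
  exact cell_nerveVertex x _

/-- Every path between vertices of a classifying space is homotopic to a concatenation of edges. -/
theorem EdgeClosed.all (hP : EdgeClosed P) {x y : D}
    (p : Path.Homotopic.Quotient (point x) (point y)) :
    P p := by
  -- The statement is extended to paths between arbitrary points by joining these points to the first
  -- vertices of simplices on which they lie.
  have key := path_induction_realization (X := nerve D) (P := fun a b p =>
    ∀ {m n : ℕ} (σ : nerve D _⦋m⦌) (s : stdSimplex ℝ (Fin (m + 1)))
      (τ : nerve D _⦋n⦌) (t : stdSimplex ℝ (Fin (n + 1)))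
      (h : cell σ s = a) (h' : cell τ t = b),
      P ((vertexClass σ s h).trans (p.trans (vertexClass τ t h').symm))) ?_ ?_ p
    (nerveVertex x) default (nerveVertex y) default rfl rfl
  · exact Eq.mp (congrArg (@P x y) ((congrArg₂ Path.Homotopic.Quotient.trans
      (vertexClass_nerveVertex x) (congrArg (Path.Homotopic.Quotient.trans p)
        (congrArg Path.Homotopic.Quotient.symm (vertexClass_nerveVertex y)))).trans
      ((Path.Homotopic.Quotient.refl_trans _).trans ((congrArg (Path.Homotopic.Quotient.trans p)
        (congrArg Path.Homotopic.Quotient.mk Path.refl_symm)).trans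
        (Path.Homotopic.Quotient.trans_refl p))))) key
  · intro a b c p q hp hq m n σ s τ t h h'
    obtain ⟨k, ρ, r, hr⟩ := exists_cell b
    have := hP.trans (hp σ s ρ r h hr) (hq ρ r τ t hr h')
    rwa [Path.Homotopic.Quotient.trans_assoc, Path.Homotopic.Quotient.trans_assoc,
      symm_trans_cancel, ← Path.Homotopic.Quotient.trans_assoc p] at this
  · intro k ρ s' t' α m n σ s τ t h h'
    have h1 := hP.trans (hP.vertexClass_vertexClass σ s ρ s' h rfl)
      (hP.vertexClass_vertexClass ρ t' τ t rfl h')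
    have h2 : vertexClass ρ t' rfl = (vertexClass ρ s' rfl).trans
        (Path.Homotopic.Quotient.mk (α.map (cell ρ).continuous)) :=
      mk_eq_trans_of_simplex ρ (simplexSegment (stdSimplex.vertex 0) s') α
        (simplexSegment (stdSimplex.vertex 0) t') (fun _ => rfl) (fun _ => rfl) (fun _ => rfl)
    rwa [h2, Path.Homotopic.Quotient.trans_assoc, Path.Homotopic.Quotient.trans_assoc,
      symm_trans_cancel] at h1

end EdgePaths

end QuasiExact

/-! ### Step functions and their orbits under a group -/

namespace QuasiExact

section StepSpace

/-- The functions on the half-open unit interval with values in `G`. Their distance is the (outer)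
measure of the set where they differ, so that the pseudometric space `StepSpace G` is not
separated. -/
def StepSpace (G : Type u) : Type u := Set.Ico (0 : ℝ) 1 → G

namespace StepSpace

variable {G : Type u}

noncomputable instance : PseudoEMetricSpace (StepSpace G) where
  edist f g := MeasureTheory.volume (Subtype.val '' {s | f s ≠ g s})
  edist_self f := by simp
  edist_comm f g := by simp_rw [ne_comm]
  edist_triangle f g h := by
    refine (MeasureTheory.measure_mono ?_).trans (MeasureTheory.measure_union_le _ _)
    rw [← Set.image_union]
    refine Set.image_mono fun s hs => ?_
    by_contra hn
    rw [Set.mem_union, not_or] at hn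
    exact hs ((not_not.1 hn.1).trans (not_not.1 hn.2))

lemma edist_eq (f g : StepSpace G) :
    edist f g = MeasureTheory.volume (Subtype.val '' {s | f s ≠ g s}) := rfl

variable [Group G]

instance : MulAction G (StepSpace G) := inferInstanceAs (MulAction G (Set.Ico (0 : ℝ) 1 → G))

lemma smul_apply (g : G) (f : StepSpace G) (s : Set.Ico (0 : ℝ) 1) : (g • f) s = g * f s := rfl

instance : IsIsometricSMul G (StepSpace G) where
  isometry_smul g f f' := by
    simp only [edist_eq, smul_apply, ne_eq, mul_right_inj]

/-- Distinct points of an orbit have distance `1`, whence the translates of balls of radius `1 / 2`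
are disjoint. -/
lemma edist_smul_self {g : G} (hg : g ≠ 1) (f : StepSpace G) : edist (g • f) f = 1 := by
  have : {s | (g • f) s ≠ f s} = Set.univ := by
    refine Set.eq_univ_of_forall fun s => ?_
    simpa [smul_apply] using hg
  rw [edist_eq, this, Set.image_univ, Subtype.range_coe, Real.volume_Ico, sub_zero,
    ENNReal.ofReal_one]

/-- The quotient of `StepSpace G` by the action of `G`. It plays the role of a classifying space of
the discrete group `G`: the quotient map is a covering with group `G`. -/
abbrev Orbits (G : Type u) [Group G] : Type u := MulAction.orbitRel.Quotient G (StepSpace G)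

lemma isQuotientCoveringMap :
    IsQuotientCoveringMap (Quotient.mk (MulAction.orbitRel G (StepSpace G))) G where
  __ := isQuotientMap_quotient_mk'
  continuous_const_smul g := (isometry_smul _ g).continuous
  apply_eq_iff_mem_orbit := Quotient.eq''
  disjoint f := by
    refine ⟨Metric.eball f 2⁻¹, Metric.eball_mem_nhds _ (by simp),
      fun g ⟨_, ⟨a, ha, rfl⟩, hb⟩ => ?_⟩
    by_contra hg
    have h := (edist_triangle_right (g • a) a f).trans_lt (ENNReal.add_lt_add hb ha)
    rw [edist_smul_self hg, ENNReal.inv_two_add_inv_two] at h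
    exact h.false

end StepSpace

section Index

variable {n : ℕ}

/-- The points of a simplex are the partitions of the half-open unit interval into consecutive
intervals of given lengths; the index of `s` is the number of the interval which contains it. -/
def IsIndex (t : stdSimplex ℝ (Fin (n + 1))) (s : ℝ) (i : Fin (n + 1)) : Prop :=
  ∑ j with j < i, t j ≤ s ∧ s < ∑ j with j ≤ i, t j

lemma sum_le_sum_of_imp (t : stdSimplex ℝ (Fin (n + 1))) {p q : Fin (n + 1) → Prop}
    [DecidablePred p] [DecidablePred q] (h : ∀ i, p i → q i) :
    ∑ j with p j, t j ≤ ∑ j with q j, t j :=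
  Finset.sum_le_sum_of_subset_of_nonneg (Finset.monotone_filter_right _ fun i _ => h i)
    fun _ _ _ => t.2.1 _

lemma exists_isIndex (t : stdSimplex ℝ (Fin (n + 1))) (s : Set.Ico (0 : ℝ) 1) :
    ∃ i, IsIndex t s i := by
  classical
  have hne : ∃ k, ∃ i : Fin (n + 1), (i : ℕ) = k ∧ (s : ℝ) < ∑ j with j ≤ i, t j := by
    refine ⟨_, Fin.last n, rfl, ?_⟩
    simp only [Fin.le_last, Finset.filter_true]
    exact s.2.2.trans_eq t.2.2.symm
  obtain ⟨i, hi, hs⟩ := Nat.find_spec hne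
  refine ⟨i, ?_, hs⟩
  obtain h0 | ⟨k, rfl⟩ := Fin.eq_zero_or_eq_succ i
  · subst h0
    simpa using s.2.1
  · have hlt := Nat.find_min hne (m := k) (by rw [← hi]; simp)
    have := fun h => hlt ⟨k.castSucc, by simp, h⟩
    simpa [Fin.le_castSucc_iff] using this

lemma IsIndex.le_of_le {t : stdSimplex ℝ (Fin (n + 1))} {s : ℝ} {i i' : Fin (n + 1)}
    (h : IsIndex t s i) (h' : IsIndex t s i') : i ≤ i' := by
  by_contra! hlt
  exact absurd (h'.2.trans_le (sum_le_sum_of_imp t fun j hj => hj.trans_lt hlt)) h.1.not_gt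

/-- The map of simplices given by a monotone map merges adjacent intervals and inserts empty ones. -/
lemma IsIndex.map {m : ℕ} {t : stdSimplex ℝ (Fin (m + 1))} {s : ℝ} {i : Fin (m + 1)}
    (h : IsIndex t s i) {θ : Fin (m + 1) → Fin (n + 1)} (hθ : Monotone θ) :
    IsIndex (stdSimplex.map θ t) s (θ i) := by
  have key (p : Fin (n + 1) → Prop) [DecidablePred p] :
      ∑ k with p k, stdSimplex.map θ t k = ∑ j with p (θ j), t j := by
    rw [← Finset.sum_fiberwise_of_maps_to (g := θ) (t := Finset.univ.filter p)
      fun j hj => by simpa using hj]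
    refine Finset.sum_congr rfl fun k hk => ?_
    rw [stdSimplex_map_apply, Finset.filter_filter]
    refine Finset.sum_congr (Finset.filter_congr fun j _ => ?_) fun _ _ => rfl
    exact ⟨fun h => ⟨h ▸ (Finset.mem_filter.1 hk).2, h⟩, fun h => h.2⟩
  rw [IsIndex, key, key]
  exact ⟨(sum_le_sum_of_imp t fun j hj => hθ.reflect_lt hj).trans h.1,
    h.2.trans_le (sum_le_sum_of_imp t fun j hj => hθ hj)⟩

/-- The index of a point of the unit interval, see `IsIndex`. -/
noncomputable def index (t : stdSimplex ℝ (Fin (n + 1))) (s : Set.Ico (0 : ℝ) 1) : Fin (n + 1) :=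
  (exists_isIndex t s).choose

lemma isIndex_index (t : stdSimplex ℝ (Fin (n + 1))) (s : Set.Ico (0 : ℝ) 1) :
    IsIndex t s (index t s) := (exists_isIndex t s).choose_spec

lemma IsIndex.index_eq {t : stdSimplex ℝ (Fin (n + 1))} {s : Set.Ico (0 : ℝ) 1} {i : Fin (n + 1)}
    (h : IsIndex t s i) : index t s = i :=
  le_antisymm ((isIndex_index t s).le_of_le h) (h.le_of_le (isIndex_index t s))

lemma index_map {m : ℕ} (t : stdSimplex ℝ (Fin (m + 1))) (s : Set.Ico (0 : ℝ) 1)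
    {θ : Fin (m + 1) → Fin (n + 1)} (hθ : Monotone θ) :
    index (stdSimplex.map θ t) s = θ (index t s) :=
  ((isIndex_index t s).map hθ).index_eq

variable {G : Type u}

/-- The step function with given values, on consecutive intervals of given lengths. -/
noncomputable def step (h : Fin (n + 1) → G) (t : stdSimplex ℝ (Fin (n + 1))) : StepSpace G :=
  fun s => h (index t s)

/-- If the lengths of the intervals change, then the step function changes at most between the old and
the new endpoints. -/
lemma continuous_step (h : Fin (n + 1) → G) : Continuous (step h) := by
  let c (i : Fin (n + 1)) (t : stdSimplex ℝ (Fin (n + 1))) : ℝ := ∑ j with j ≤ i, t j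
  have hc (i) : Continuous (c i) := continuous_finsetSum _ fun j _ => continuous_coord j
  have hle (t t') : edist (step h t) (step h t') ≤ ∑ i, ENNReal.ofReal |c i t - c i t'| := by
    have hsub : Subtype.val '' {s | step h t s ≠ step h t' s} ⊆
        ⋃ i ∈ Finset.univ, Set.uIcc (c i t') (c i t) := by
      rintro _ ⟨s, hs, rfl⟩
      have hi := isIndex_index t s
      have hi' := isIndex_index t' s
      have hne : index t s ≠ index t' s := fun e => hs (congrArg h e)
      simp only [Finset.mem_univ, Set.iUnion_true, Set.mem_iUnion]
      obtain hlt | hlt := lt_or_gt_of_ne hne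
      · exact ⟨index t s, Set.Icc_subset_uIcc
          ⟨(sum_le_sum_of_imp t' fun j hj => hj.trans_lt hlt).trans hi'.1, hi.2.le⟩⟩
      · exact ⟨index t' s, Set.Icc_subset_uIcc'
          ⟨(sum_le_sum_of_imp t fun j hj => hj.trans_lt hlt).trans hi.1, hi'.2.le⟩⟩
    refine (MeasureTheory.measure_mono hsub).trans
      ((MeasureTheory.measure_biUnion_finset_le _ _).trans_eq ?_)
    simp only [Real.volume_interval]
  rw [continuous_iff_continuousAt]
  intro t
  rw [ContinuousAt, tendsto_iff_edist_tendsto_0]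
  refine tendsto_of_tendsto_of_tendsto_of_le_of_le tendsto_const_nhds ?_ (fun _ => zero_le)
    fun t' => hle t' t
  have hcont : Continuous fun t' => ∑ i, ENNReal.ofReal |c i t' - c i t| :=
    continuous_finsetSum _ fun i _ => ENNReal.continuous_ofReal.comp
      ((hc i).sub continuous_const).abs
  simpa using hcont.tendsto t

/-- The constant functions. -/
def StepSpace.const (g : G) : StepSpace G := fun _ => g

lemma step_vertex {n : ℕ} (h : Fin (n + 1) → G) (i : Fin (n + 1)) :
    step h (stdSimplex.vertex i) = StepSpace.const (h i) := by
  funext s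
  refine congrArg h (IsIndex.index_eq ⟨?_, ?_⟩)
  · rw [Finset.sum_eq_zero fun j hj => ?_]
    · exact s.2.1
    · exact Pi.single_eq_of_ne (Finset.mem_filter.1 hj).2.ne _
  · rw [Finset.sum_eq_single_of_mem i (by simp) fun j _ hj => Pi.single_eq_of_ne hj _]
    exact s.2.2.trans_eq (Pi.single_eq_same (M := fun _ : Fin (n + 1) => ℝ) i 1).symm

/-- The path of step functions from the constant function `1` to the constant function `g`, in
which the step moves across the unit interval. -/
noncomputable def stepPath [One G] (g : G) : Path (StepSpace.const 1) (StepSpace.const g) :=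
  ((simplexSegment (stdSimplex.vertex 0) (stdSimplex.vertex 1)).map
    (continuous_step ![1, g])).cast (step_vertex ![1, g] 0).symm (step_vertex ![1, g] 1).symm

end Index

end StepSpace

end QuasiExact

/-! ### Labels of morphisms and of paths -/

namespace QuasiExact

section Labels

variable {D : Type u} [Category.{v} D]

lemma nerveHom_comp {n : ℕ} (σ : nerve D _⦋n⦌) {i j k : Fin (n + 1)} (h : i ≤ j) (h' : j ≤ k) :
    nerveHom σ h ≫ nerveHom σ h' = nerveHom σ (h.trans h') :=
  (Functor.map_comp (C := Fin (n + 1)) (D := D) σ (homOfLE h) (homOfLE h')).symm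

variable {G : Type u} [Group G]

/-- A multiplicative labelling of the morphisms of a category by elements of a group. -/
structure IsLabelling (F : ∀ ⦃x y : D⦄, (x ⟶ y) → G) : Prop where
  map_comp {x y z : D} (f : x ⟶ y) (g : y ⟶ z) : F (f ≫ g) = F f * F g

variable {F : ∀ ⦃x y : D⦄, (x ⟶ y) → G}

lemma IsLabelling.map_id (hF : IsLabelling F) (x : D) : F (𝟙 x) = 1 := by
  have h := hF.map_comp (𝟙 x) (𝟙 x)
  rwa [Category.comp_id, left_eq_mul] at h

variable (F) in
/-- The step function at a point of a simplex: its values are the labels of the morphisms from the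
first vertex to the other ones, and the barycentric coordinates are the lengths of the steps. -/
noncomputable def labelStep {n : ℕ} (σ : nerve D _⦋n⦌) : stdSimplex ℝ (Fin (n + 1)) → StepSpace G :=
  step fun i => F (nerveHom σ (Fin.zero_le i))

/-- Passing to a face changes the step function by the label of the morphism between the first
vertices, which disappears in the space of orbits. -/
lemma IsLabelling.smul_labelStep_map (hF : IsLabelling F) {m n : ℕ} (θ : ⦋m⦌ ⟶ ⦋n⦌)
    (σ : nerve D _⦋n⦌) (t : stdSimplex ℝ (Fin (m + 1))) :
    F (nerveHom σ (Fin.zero_le (θ 0))) • labelStep F ((nerve D).map θ.op σ) t =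
      labelStep F σ (stdSimplex.map θ t) := by
  funext s
  refine (hF.map_comp _
    (nerveHom σ (θ.toOrderHom.monotone (Fin.zero_le (index t s))))).symm.trans ?_
  rw [nerveHom_comp]
  have key (i : Fin (n + 1)) (hi : i = θ (index t s)) :
      F (nerveHom σ (Fin.zero_le (θ (index t s)))) = F (nerveHom σ (Fin.zero_le i)) := by
    subst hi
    rfl
  exact key _ (index_map t s θ.toOrderHom.monotone)

/-- A labelling of a category gives a map from its classifying space to the space of orbits. -/
lemma IsLabelling.exists_map (hF : IsLabelling F) :
    ∃ Ψ : C(ClassifyingSpace D, StepSpace.Orbits G), ∀ {n : ℕ} (σ : nerve D _⦋n⦌)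
      (t : stdSimplex ℝ (Fin (n + 1))), Ψ (cell σ t) = Quotient.mk _ (labelStep F σ t) := by
  obtain ⟨Ψ, hΨ⟩ := exists_desc (X := nerve D)
    (Y := TopCat.of (ULift.{max u v} (StepSpace.Orbits G)))
    (fun _ σ => ⟨fun t => ULift.up (Quotient.mk _ (labelStep F σ t)),
      continuous_uliftUp.comp (continuous_quotient_mk'.comp (continuous_step _))⟩)
    fun θ σ t => congrArg ULift.up
      ((congrArg (Quotient.mk (MulAction.orbitRel G (StepSpace G)))
        (hF.smul_labelStep_map θ σ t).symm).trans
          (StepSpace.isQuotientCoveringMap.map_smul _)).symm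
  exact ⟨⟨fun y => (Ψ y).down, continuous_uliftDown.comp Ψ.continuous⟩,
    fun σ t => congrArg ULift.down (hΨ σ t)⟩

lemma IsLabelling.labelStep_nerveVertex (hF : IsLabelling F) (x : D) :
    labelStep F (nerveVertex x) default = StepSpace.const 1 := by
  funext s
  have key (i : Fin 1) : F (nerveHom (nerveVertex x) (Fin.zero_le i)) = 1 := by
    obtain rfl := Subsingleton.elim i 0
    exact hF.map_id x
  exact key _

lemma IsLabelling.labelStep_nerveEdge (hF : IsLabelling F) {x y : D} (f : x ⟶ y)
    (t : stdSimplex ℝ (Fin 2)) : labelStep F (nerveEdge f) t = step ![1, F f] t := by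
  refine congrArg (fun h => step h t) (funext fun i => ?_)
  fin_cases i
  · exact hF.map_id x
  · rfl

lemma quotient_map_trans {S T : Type*} [TopologicalSpace S] [TopologicalSpace T] {a b c : S}
    (p : Path.Homotopic.Quotient a b) (q : Path.Homotopic.Quotient b c) (f : C(S, T)) :
    (p.trans q).map f = (p.map f).trans (q.map f) := by
  obtain ⟨p, rfl⟩ := Path.Homotopic.Quotient.mk_surjective p
  obtain ⟨q, rfl⟩ := Path.Homotopic.Quotient.mk_surjective q
  exact congrArg Path.Homotopic.Quotient.mk (Path.map_trans p q f.continuous)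

/-- A labelling extends from the morphisms to the classes of paths between vertices: the label of a
path is its monodromy under the covering of the space of orbits by the space of step functions. -/
theorem IsLabelling.exists_extension (hF : IsLabelling F) :
    ∃ Φ : ∀ ⦃x y : D⦄, Path.Homotopic.Quotient (point x) (point y) → G,
      (∀ {x y z : D} (p : Path.Homotopic.Quotient (point x) (point y))
        (q : Path.Homotopic.Quotient (point y) (point z)), Φ (p.trans q) = Φ p * Φ q) ∧
      ∀ {x y : D} (f : x ⟶ y), Φ (Path.Homotopic.Quotient.mk (edgePath f)) = F f := by
  obtain ⟨Ψ, hΨ⟩ := hF.exists_map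
  let π : StepSpace G → StepSpace.Orbits G := Quotient.mk (MulAction.orbitRel G (StepSpace G))
  have hπ : IsQuotientCoveringMap π G := StepSpace.isQuotientCoveringMap
  have hpt (x : D) : π (StepSpace.const 1) = Ψ (point x) := by
    rw [← hF.labelStep_nerveVertex x, ← cell_nerveVertex x default, hΨ]
  have hend {x y : D} (f : x ⟶ y) : π (StepSpace.const (F f)) = Ψ (point y) := by
    rw [← hpt y]
    exact hπ.apply_eq_iff_mem_orbit.2 ⟨F f, funext fun _ => mul_one _⟩
  let e (x : D) : π ⁻¹' {Ψ (point x)} := ⟨_, hpt x⟩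
  let M {x y : D} (p : Path.Homotopic.Quotient (point x) (point y)) : π ⁻¹' {Ψ (point y)} :=
    hπ.isCoveringMap.monodromy (p.map Ψ) (e x)
  refine ⟨fun x y p => hπ.fiberEquivGroup (e y) (M p), fun {x y z} p q => ?_, fun {x y} f => ?_⟩
  · rw [IsQuotientCoveringMap.fiberEquivGroup_eq_iff]
    have h1 : M p = hπ.toPermFiber _ (hπ.fiberEquivGroup (e y) (M p)) (e y) :=
      Subtype.ext (hπ.fiberEquivGroup_smul_self (e y)).symm
    have h2 : M (p.trans q) = hπ.toPermFiber _ (hπ.fiberEquivGroup (e y) (M p)) (M q) := by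
      rw [← hπ.monodromy_toPermFiber, ← h1]
      refine Eq.trans ?_ (hπ.isCoveringMap.monodromy_trans_apply _ _ _)
      exact congrArg (fun r => hπ.isCoveringMap.monodromy r (e x))
        (quotient_map_trans p q Ψ)
    rw [h2, mul_smul, hπ.fiberEquivGroup_smul_self]
    rfl
  · rw [IsQuotientCoveringMap.fiberEquivGroup_eq_iff]
    have h : M (Path.Homotopic.Quotient.mk (edgePath f)) =
        ⟨StepSpace.const (F f), hend f⟩ := by
      refine hπ.isCoveringMap.monodromy_eq_of_map_eq
        (Path.Homotopic.Quotient.mk (stepPath (F f))) ?_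
      refine congrArg Path.Homotopic.Quotient.mk (Path.ext (funext fun u => ?_))
      refine (congrArg π (hF.labelStep_nerveEdge f _).symm).trans ((hΨ _ _).symm.trans ?_)
      exact congrArg Ψ (edgePath_apply f u).symm
    rw [h]
    funext s
    exact (mul_one _).symm

end Labels

end QuasiExact

/-! ### The loops of the objects of a quasi-exact category -/

namespace QuasiExact

section EdgeFunctor

variable {D : Type u} [Category.{v} D]

lemma mk_edgePath_comp {x y z : D} (f : x ⟶ y) (g : y ⟶ z) :
    Path.Homotopic.Quotient.mk (edgePath (f ≫ g)) =
      (Path.Homotopic.Quotient.mk (edgePath f)).trans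
        (Path.Homotopic.Quotient.mk (edgePath g)) := by
  let σ : nerve D _⦋2⦌ := ComposableArrows.mk₂ f g
  exact mk_eq_trans_of_simplex σ (simplexSegment (stdSimplex.vertex 0) (stdSimplex.vertex 1))
    (simplexSegment (stdSimplex.vertex 1) (stdSimplex.vertex 2))
    (simplexSegment (stdSimplex.vertex 0) (stdSimplex.vertex 2))
    (edgePath_nerveHom σ (i := 0) (j := 1) (by decide))
    (edgePath_nerveHom σ (i := 1) (j := 2) (by decide))
    (edgePath_nerveHom σ (i := 0) (j := 2) (by decide))

lemma mk_edgePath_id (x : D) :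
    Path.Homotopic.Quotient.mk (edgePath (𝟙 x)) = Path.Homotopic.Quotient.refl (point x) := by
  have h := mk_edgePath_comp (𝟙 x) (𝟙 x)
  rw [Category.comp_id] at h
  have h' := symm_trans_cancel (Path.Homotopic.Quotient.mk (edgePath (𝟙 x)))
    (Path.Homotopic.Quotient.mk (edgePath (𝟙 x)))
  rw [← h, Path.Homotopic.Quotient.symm_trans] at h'
  exact h'.symm

/-- The functor from a category to the fundamental groupoid of its classifying space which sends
a morphism to the class of its edge. -/
noncomputable def edgeFunctor (D : Type u) [Category.{v} D] :
    D ⥤ FundamentalGroupoid (ClassifyingSpace D) where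
  obj x := ⟨point x⟩
  map f := Path.Homotopic.Quotient.mk (edgePath f)
  map_id x := mk_edgePath_id x
  map_comp f g := mk_edgePath_comp f g

end EdgeFunctor

namespace QuasiExactStructure

variable {C : Type u} [Category.{v} C] [HasZeroMorphisms C] {A : QuasiExactStructure C}

section Squares

/-- The kernel of an `E`-cokernel is its base change along the map from a zero object. -/
lemma isPullback_of_mem {K Y X z : C} (hz : IsZero z) {k : K ⟶ Y} {j : Y ⟶ X} {w : k ≫ j = 0}
    (h : A.E (ShortComplex.mk k j w)) : IsPullback (0 : K ⟶ z) k (0 : z ⟶ X) j := by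
  obtain ⟨⟨hl⟩, -⟩ := A.strongExact _ h
  refine ⟨⟨by rw [zero_comp, w]⟩, ⟨PullbackCone.IsLimit.mk _
    (fun s => (KernelFork.IsLimit.lift' hl s.snd ?_).1) (fun s => hz.eq_of_tgt _ _)
    (fun s => (KernelFork.IsLimit.lift' hl s.snd _).2) fun s m _ h2 => ?_⟩⟩
  · rw [← s.condition, comp_zero]
  · exact Fork.IsLimit.hom_ext hl
      (h2.trans (KernelFork.IsLimit.lift' hl s.snd (by rw [← s.condition, comp_zero])).2.symm)

end Squares

section Membership

variable {K Y X : C} {k : K ⟶ Y} {j : Y ⟶ X} {w : k ≫ j = 0}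

lemma isKer_of_mem (h : A.E (ShortComplex.mk k j w)) : A.IsKer k := ⟨X, j, w, h⟩

lemma isCoker_of_mem (h : A.E (ShortComplex.mk k j w)) : A.IsCoker j := ⟨K, k, w, h⟩

end Membership

section Shriek

lemma shriekLower_comp_shriekLower {X Y Z : C} {i : X ⟶ Y} {i' : Y ⟶ Z} (hi : A.IsKer i)
    (hi' : A.IsKer i') :
    shriekLower i hi ≫ shriekLower i' hi' = shriekLower (i ≫ i') (A.kernel_comp i i' hi hi') := by
  refine (qComp_mk _ _ (IsPullback.of_id_fst : IsPullback (𝟙 X) i i (𝟙 Y))).trans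
    (Quotient.sound ⟨Iso.refl _, ?_, ?_⟩)
  · exact Category.id_comp _
  · rfl

lemma shriekUpper_comp_shriekUpper {X Y Z : C} {j : Y ⟶ X} {j' : Z ⟶ Y} (hj : A.IsCoker j)
    (hj' : A.IsCoker j') :
    shriekUpper j hj ≫ shriekUpper j' hj' =
      shriekUpper (j' ≫ j) (A.cokernel_comp j' j hj' hj) := by
  refine (qComp_mk _ _ (IsPullback.of_id_snd : IsPullback j' (𝟙 Z) (𝟙 Y) j')).trans
    (Quotient.sound ⟨Iso.refl _, ?_, ?_⟩)
  · rfl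
  · exact Category.id_comp _

lemma mk_eq_shriekUpper_comp_shriekLower {X Y : C} (a : A.QSpan X Y) :
    (Quotient.mk (A.qSpanSetoid X Y) a : (QCat.of X : A.QCat) ⟶ QCat.of Y) =
      shriekUpper a.j a.isCoker ≫ shriekLower a.i a.isKer := by
  refine Eq.symm ((qComp_mk _ _ (IsPullback.of_id_fst :
    IsPullback (𝟙 a.S) (𝟙 a.S) (𝟙 a.S) (𝟙 a.S))).trans (Quotient.sound ⟨Iso.refl _, ?_, ?_⟩))
  · rfl
  · rfl

/-- The base change formula in `QC`. -/
lemma shriekLower_comp_shriekUpper {P S T Y : C} {p : P ⟶ S} {q : P ⟶ T} {i : S ⟶ Y}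
    {j : T ⟶ Y} (h : IsPullback p q i j) (hi : A.IsKer i) (hj : A.IsCoker j) :
    shriekLower i hi ≫ shriekUpper j hj =
      shriekUpper p (A.cokernel_baseChange h hi hj) ≫
        shriekLower q (A.kernel_baseChange h hi hj) := by
  let b : A.QSpan S T :=
    { S := P, i := q, j := p, isKer := A.kernel_baseChange h hi hj
      isCoker := A.cokernel_baseChange h hi hj }
  have hc : shriekLower i hi ≫ shriekUpper j hj = (Quotient.mk (A.qSpanSetoid S T) b) :=
    (qComp_mk ⟨S, i, 𝟙 S, hi, A.isCoker_id S⟩ ⟨T, 𝟙 T, j, A.isKer_id T, hj⟩ h).trans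
      (Quotient.sound ⟨Iso.refl _, (Category.id_comp _).trans (Category.comp_id _).symm,
        (Category.id_comp _).trans (Category.comp_id _).symm⟩)
  exact hc.trans (mk_eq_shriekUpper_comp_shriekLower b)

end Shriek

section Loops

variable {z : C} (hz : IsZero z)

variable (A) in
/-- The morphism `i_!` of `QC`, where `i` is the map from a zero object to `X`. -/
def fromZero (X : C) : (QCat.of z : A.QCat) ⟶ QCat.of X :=
  shriekLower (0 : z ⟶ X) (A.isKer_zero hz X)

variable (A) in
/-- The morphism `j^!` of `QC`, where `j` is the map from `X` to a zero object. -/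
def toZero (X : C) : (QCat.of z : A.QCat) ⟶ QCat.of X :=
  shriekUpper (0 : X ⟶ z) (A.isCoker_zero hz X)

lemma fromZero_comp {X Y : C} {i : X ⟶ Y} (hi : A.IsKer i) :
    A.fromZero hz X ≫ shriekLower i hi = A.fromZero hz Y := by
  refine (shriekLower_comp_shriekLower _ hi).trans ?_
  congr 1
  exact zero_comp

lemma toZero_comp {X Y : C} {j : Y ⟶ X} (hj : A.IsCoker j) :
    A.toZero hz X ≫ shriekUpper j hj = A.toZero hz Y := by
  refine (shriekUpper_comp_shriekUpper _ hj).trans ?_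
  congr 1
  exact comp_zero

/-- The base change formula for the map from a zero object. -/
lemma fromZero_comp_shriekUpper {K Y X : C} {k : K ⟶ Y} {j : Y ⟶ X} {w : k ≫ j = 0}
    (h : A.E (ShortComplex.mk k j w)) :
    A.fromZero hz X ≫ shriekUpper j (isCoker_of_mem h) =
      A.toZero hz K ≫ shriekLower k (isKer_of_mem h) :=
  shriekLower_comp_shriekUpper (isPullback_of_mem hz h) _ _

variable {H : Type*} [Groupoid H] (E : A.QCat ⥤ H)

/-- The loop given by an object `X` under a functor from `QC` to a groupoid. Products in `End` are
composites in the reverse order. -/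
def loop (X : C) : End (E.obj (QCat.of z)) :=
  E.map (A.toZero hz X) ≫ Groupoid.inv (E.map (A.fromZero hz X))

lemma loop_comp_map (X : C) :
    loop hz E X ≫ E.map (A.fromZero hz X) = E.map (A.toZero hz X) := by
  rw [loop, Category.assoc, Groupoid.inv_comp, Category.comp_id]

lemma map_fromZero_shriekUpper {K Y X : C} {k : K ⟶ Y} {j : Y ⟶ X} {w : k ≫ j = 0}
    (h : A.E (ShortComplex.mk k j w)) :
    E.map (A.fromZero hz X) ≫ E.map (shriekUpper j (isCoker_of_mem h)) =
      loop hz E K ≫ E.map (A.fromZero hz Y) := by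
  rw [← E.map_comp, fromZero_comp_shriekUpper hz h, E.map_comp, ← loop_comp_map, Category.assoc,
    ← E.map_comp, fromZero_comp]

/-- The loop of the middle term of a sequence of the class is the composite of the other two. -/
lemma loop_eq_of_mem {K Y X : C} {k : K ⟶ Y} {j : Y ⟶ X} {w : k ≫ j = 0}
    (h : A.E (ShortComplex.mk k j w)) :
    loop hz E Y = loop hz E K * loop hz E X := by
  rw [End.mul_def]
  have h1 : loop hz E Y ≫ E.map (A.fromZero hz Y) =
      (loop hz E X ≫ loop hz E K) ≫ E.map (A.fromZero hz Y) := by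
    rw [loop_comp_map, ← toZero_comp hz (isCoker_of_mem h), E.map_comp, ← loop_comp_map,
      Category.assoc, map_fromZero_shriekUpper hz E h, Category.assoc]
  exact (cancel_mono _).1 h1

/-- The loops commute, since both orders of the product come from a sum of two objects. -/
lemma loop_mul_comm (X Y : C) : loop hz E X * loop hz E Y = loop hz E Y * loop hz E X := by
  have : ∀ X Y : C, HasBinaryCoproduct X Y := A.hasBinaryCoproduct
  have : HasBinaryCoproducts C := hasBinaryCoproducts_of_hasColimit_pair C
  have h : A.E (ShortComplex.mk (coprod.inr : Y ⟶ X ⨿ Y) (coprod.desc (𝟙 X) (0 : Y ⟶ X))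
      (coprod.inr_desc _ _)) := by
    refine A.closed _ _ ⟨?_⟩ (A.sum_mem Y X)
    have h2 : coprod.desc coprod.inr coprod.inl ≫ coprod.desc (𝟙 X) (0 : Y ⟶ X) =
        coprod.desc (0 : Y ⟶ X) (𝟙 X) := by
      rw [coprod.desc_comp, coprod.inr_desc, coprod.inl_desc]
    exact ShortComplex.isoMk (Iso.refl _) (coprod.braiding Y X) (Iso.refl _)
      ((Category.id_comp _).trans (coprod.inl_desc _ _).symm) (h2.trans (Category.comp_id _).symm)
  exact (loop_eq_of_mem hz E (A.sum_mem X Y)).symm.trans (loop_eq_of_mem hz E h)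

/-- Up to the paths given by the zero object, the image of any morphism of `QC` is a loop. -/
lemma exists_map_eq_loop {X Y : C} (f : (QCat.of X : A.QCat) ⟶ QCat.of Y) :
    ∃ K, E.map (A.fromZero hz X) ≫ E.map f = loop hz E K ≫ E.map (A.fromZero hz Y) := by
  obtain ⟨a, rfl⟩ := Quotient.exists_rep f
  obtain ⟨K, k, w, h⟩ := a.isCoker
  refine ⟨K, ?_⟩
  rw [mk_eq_shriekUpper_comp_shriekLower, E.map_comp, ← Category.assoc,
    map_fromZero_shriekUpper hz E h, Category.assoc, ← E.map_comp, fromZero_comp]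

end Loops

end QuasiExactStructure

end QuasiExact

/-! ### The Grothendieck group and the fundamental group -/

namespace QuasiExact

namespace QuasiExactStructure

variable {C : Type u} [Category.{v} C] [HasZeroMorphisms C] (A : QuasiExactStructure C)

section GrothendieckGroup

variable {A}

lemma k0Class_eq_of_mem {K Y X : C} {k : K ⟶ Y} {j : Y ⟶ X} {w : k ≫ j = 0}
    (h : A.E (ShortComplex.mk k j w)) : A.k0Class Y = A.k0Class K + A.k0Class X := by
  rw [← sub_eq_zero]
  refine (QuotientAddGroup.eq_zero_iff
    (FreeAbelianGroup.of Y - (FreeAbelianGroup.of K + FreeAbelianGroup.of X))).2 ?_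
  exact AddSubgroup.subset_closure ⟨_, h, rfl⟩

lemma k0Class_zero {z : C} (hz : IsZero z) : A.k0Class z = 0 :=
  left_eq_add.1 (k0Class_eq_of_mem (left_zero_mem z hz))

lemma k0Class_eq_of_iso {X Y : C} (e : X ≅ Y) : A.k0Class X = A.k0Class Y := by
  obtain ⟨z, hz⟩ := A.hasZeroObject
  have h : A.E (ShortComplex.mk (0 : z ⟶ X) e.hom zero_comp) :=
    A.closed _ _ ⟨ShortComplex.isoMk (Iso.refl z) (Iso.refl X) e
      (hz.eq_of_src _ _) rfl⟩ (left_zero_mem X hz)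
  rw [k0Class_eq_of_mem h, k0Class_zero hz, zero_add]

/-- The additivity of the class in the Grothendieck group on a cartesian square, which holds because
the kernels of the two parallel cokernels are isomorphic. -/
lemma k0Class_add_eq_of_isPullback {P S T Y : C} {p : P ⟶ S} {q : P ⟶ T} {i : S ⟶ Y}
    {j : T ⟶ Y} (h : IsPullback p q i j) (hi : A.IsKer i) (hj : A.IsCoker j) :
    A.k0Class P + A.k0Class Y = A.k0Class S + A.k0Class T := by
  obtain ⟨z, hz⟩ := A.hasZeroObject
  obtain ⟨K, k, w, hE⟩ := hj
  obtain ⟨K', k', w', hE'⟩ := A.cokernel_baseChange h hi ⟨K, k, w, hE⟩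
  have h1 := (isPullback_of_mem hz hE').flip.paste_horiz h.flip
  rw [zero_comp] at h1
  have e : K' ≅ K := h1.flip.isoIsPullback _ _ (isPullback_of_mem hz hE)
  rw [k0Class_eq_of_mem hE, k0Class_eq_of_mem hE', k0Class_eq_of_iso e]
  abel

variable (A) in
/-- The label `[S] - [X]` of the morphism `X ⟵ S ⟶ Y` of `QC`, in multiplicative notation. -/
def k0Label : ∀ ⦃x y : A.QCat⦄, (x ⟶ y) → Multiplicative A.K0 := fun x y =>
  Quotient.lift (s := A.qSpanSetoid x.as y.as)
    (fun a => Multiplicative.ofAdd (A.k0Class a.S - A.k0Class x.as))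
    fun a b ⟨e, _, _⟩ => by rw [k0Class_eq_of_iso e]

lemma isLabelling_k0Label : IsLabelling A.k0Label where
  map_comp {x y w} f g := by
    obtain ⟨a, rfl⟩ := Quotient.exists_rep f
    obtain ⟨b, rfl⟩ := Quotient.exists_rep g
    have h := QSpan.isPullback_pullback a b
    refine (congrArg (@k0Label _ _ _ A x w) (qComp_mk a b h)).trans ?_
    have key := k0Class_add_eq_of_isPullback h a.isKer b.isCoker
    rw [← eq_sub_iff_add_eq] at key
    refine congrArg Multiplicative.ofAdd (?_ : A.k0Class (QSpan.compOfIsPullback a b h).S -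
      A.k0Class x.as = (A.k0Class a.S - A.k0Class x.as) + (A.k0Class b.S - A.k0Class y.as))
    refine (congrArg (· - A.k0Class x.as) key).trans ?_
    abel

end GrothendieckGroup

section Homomorphism

variable {G : Type*} [CommGroup G]

/-- A function on the objects with values in a commutative group which is multiplicative on the
sequences of the class extends to the Grothendieck group. -/
lemma exists_k0_hom (l : C → G) (hl : ∀ S : ShortComplex C, A.E S → l S.X₂ = l S.X₁ * l S.X₃) :
    ∃ φ : Multiplicative A.K0 →* G, ∀ X, φ (Multiplicative.ofAdd (A.k0Class X)) = l X := by
  let φ₀ : FreeAbelianGroup C →+ Additive G := FreeAbelianGroup.lift fun X => Additive.ofMul (l X)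
  have h : AddSubgroup.closure A.k0Relations ≤ φ₀.ker := by
    rw [AddSubgroup.closure_le]
    rintro _ ⟨S, hS, rfl⟩
    have := hl S hS
    simp [φ₀, AddMonoidHom.mem_ker, this]
  refine ⟨AddMonoidHom.toMultiplicativeLeft (QuotientAddGroup.lift _ φ₀ h), fun X => ?_⟩
  exact congrArg Additive.toMul (FreeAbelianGroup.lift_apply_of _ _)

variable {A} in
lemma k0_hom_ext {G : Type*} [Group G] {φ ψ : Multiplicative A.K0 →* G}
    (h : ∀ X, φ (Multiplicative.ofAdd (A.k0Class X)) = ψ (Multiplicative.ofAdd (A.k0Class X))) :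
    φ = ψ := by
  refine MonoidHom.ext fun x => ?_
  obtain ⟨x, rfl⟩ := Multiplicative.ofAdd.surjective x
  obtain ⟨x, rfl⟩ := QuotientAddGroup.mk_surjective (s := AddSubgroup.closure A.k0Relations) x
  induction x using FreeAbelianGroup.induction_on with
  | zero => exact (map_one φ).trans (map_one ψ).symm
  | of X => exact h X
  | neg X hX => exact (map_inv φ _).trans ((congrArg _ hX).trans (map_inv ψ _).symm)
  | add x y hx hy => exact (map_mul φ _ _).trans ((congrArg₂ _ hx hy).trans (map_mul ψ _ _).symm)

end Homomorphism

section FundamentalGroup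

variable {z : C} (hz : IsZero z)

/-- A path between two objects of `QC`, made into a loop at the zero object by means of the edges
`fromZero`. -/
noncomputable def closeUp {x y : A.QCat}
    (p : (edgeFunctor A.QCat).obj x ⟶ (edgeFunctor A.QCat).obj y) :
    End ((edgeFunctor A.QCat).obj (QCat.of z)) :=
  (edgeFunctor A.QCat).map (A.fromZero hz x.as) ≫ p ≫
    Groupoid.inv ((edgeFunctor A.QCat).map (A.fromZero hz y.as))

lemma closeUp_id (x : A.QCat) : A.closeUp hz (𝟙 ((edgeFunctor A.QCat).obj x)) = 1 := by
  rw [closeUp, Category.id_comp, Groupoid.comp_inv]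
  rfl

lemma closeUp_comp {x y w : A.QCat}
    (p : (edgeFunctor A.QCat).obj x ⟶ (edgeFunctor A.QCat).obj y)
    (q : (edgeFunctor A.QCat).obj y ⟶ (edgeFunctor A.QCat).obj w) :
    A.closeUp hz (p ≫ q) = A.closeUp hz q * A.closeUp hz p := by
  simp only [closeUp, End.mul_def, Category.assoc]
  rw [← Category.assoc (Groupoid.inv _) _ (q ≫ _), Groupoid.inv_comp, Category.id_comp]

lemma closeUp_inv {x y : A.QCat}
    (p : (edgeFunctor A.QCat).obj x ⟶ (edgeFunctor A.QCat).obj y) :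
    A.closeUp hz (Groupoid.inv p) = (A.closeUp hz p)⁻¹ := by
  rw [eq_inv_iff_mul_eq_one, ← closeUp_comp, Groupoid.comp_inv, closeUp_id]

lemma exists_closeUp_map_eq {x y : A.QCat} (f : x ⟶ y) :
    ∃ K, A.closeUp hz ((edgeFunctor A.QCat).map f) = loop hz (edgeFunctor A.QCat) K := by
  obtain ⟨K, hK⟩ := exists_map_eq_loop hz (edgeFunctor A.QCat) f
  refine ⟨K, ?_⟩
  rw [closeUp, ← Category.assoc, hK, Category.assoc, Groupoid.comp_inv, Category.comp_id]

/-- The loops of the objects generate the fundamental group, since every path is a concatenation of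
edges. -/
lemma closure_range_loop :
    Subgroup.closure (Set.range (loop hz (edgeFunctor A.QCat))) = ⊤ := by
  have hP : EdgeClosed (D := A.QCat) fun x y p => A.closeUp hz (x := x) (y := y) p ∈
      Subgroup.closure (Set.range (loop hz (edgeFunctor A.QCat))) :=
    { refl x := by
        have := A.closeUp_id hz x
        exact this ▸ one_mem _
      edge f := by
        obtain ⟨K, hK⟩ := A.exists_closeUp_map_eq hz f
        exact hK ▸ Subgroup.subset_closure ⟨K, rfl⟩
      symm hp := (A.closeUp_inv hz _).symm ▸ inv_mem hp
      trans hp hq := (A.closeUp_comp hz _ _).symm ▸ mul_mem hq hp }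
  refine eq_top_iff.2 fun p _ => ?_
  let g := (edgeFunctor A.QCat).map (A.fromZero hz z)
  have h := hP.all (Groupoid.inv g ≫ p ≫ g)
  have h2 : A.closeUp hz (Groupoid.inv g ≫ p ≫ g) = p := by
    rw [closeUp]
    simp [g]
  exact h2 ▸ h

lemma fundamentalGroup_mul_comm (hz : IsZero z) (p q : End ((edgeFunctor A.QCat).obj (QCat.of z))) :
    p * q = q * p := by
  have hcomm : IsMulCommutative (Subgroup.closure (Set.range (loop hz (edgeFunctor A.QCat)))) :=
    Subgroup.isMulCommutative_closure (by
      rintro _ ⟨X, rfl⟩ _ ⟨Y, rfl⟩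
      exact loop_mul_comm hz _ X Y)
  rw [closure_range_loop] at hcomm
  exact congrArg Subtype.val (hcomm.is_comm.comm ⟨p, Subgroup.mem_top p⟩ ⟨q, Subgroup.mem_top q⟩)

/-- The homomorphism from the Grothendieck group to the fundamental group. -/
lemma exists_hom_fundamentalGroup :
    ∃ φ : Multiplicative A.K0 →* End ((edgeFunctor A.QCat).obj (QCat.of z)),
      ∀ X, φ (Multiplicative.ofAdd (A.k0Class X)) = loop hz (edgeFunctor A.QCat) X := by
  let : CommGroup (End ((edgeFunctor A.QCat).obj (QCat.of z))) :=
    { mul_comm := A.fundamentalGroup_mul_comm hz }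
  exact A.exists_k0_hom _ fun S hS => loop_eq_of_mem hz _ hS

/-- The homomorphism from the fundamental group to the Grothendieck group, given by the labels
`[S] - [X]`: the label of the edge from the zero object to `X` is `[X]` for the first half of the loop
of `X`, and it is zero for the second half. -/
lemma exists_fundamentalGroup_hom :
    ∃ ψ : End ((edgeFunctor A.QCat).obj (QCat.of z)) →* Multiplicative A.K0,
      ∀ X, ψ (loop hz (edgeFunctor A.QCat) X) = Multiplicative.ofAdd (A.k0Class X) := by
  obtain ⟨Φ, hmul, hedge⟩ := (isLabelling_k0Label (A := A)).exists_extension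
  refine ⟨MonoidHom.mk' (fun p => Φ (x := QCat.of z) (y := QCat.of z) p)
    fun p q => (hmul q p).trans (mul_comm _ _), fun X => ?_⟩
  let t := (edgeFunctor A.QCat).map (A.toZero hz X)
  let g := (edgeFunctor A.QCat).map (A.fromZero hz X)
  have h1 := hmul (x := QCat.of z) (y := QCat.of z) (z := QCat.of X)
    (loop hz (edgeFunctor A.QCat) X) g
  have h2 := congrArg (Φ (x := QCat.of z) (y := QCat.of X))
    (loop_comp_map hz (edgeFunctor A.QCat) X)
  have h3 := (h1.symm.trans h2).trans (hedge (A.toZero hz X))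
  have hfrom : A.k0Label (A.fromZero hz X) = 1 :=
    congrArg Multiplicative.ofAdd (sub_self (A.k0Class z))
  have hto : A.k0Label (A.toZero hz X) = Multiplicative.ofAdd (A.k0Class X) :=
    congrArg Multiplicative.ofAdd
      ((congrArg (A.k0Class X - ·) (k0Class_zero hz)).trans (sub_zero (A.k0Class X)))
  rw [hto] at h3
  refine Eq.trans ?_ h3
  exact (mul_one _).symm.trans (congrArg _ ((hedge (A.fromZero hz X)).trans hfrom).symm)

end FundamentalGroup

end QuasiExactStructure

end QuasiExact

theorem theorem2 {C : Type u} [Category.{v} C] [HasZeroMorphisms C]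
    (A : QuasiExact.QuasiExactStructure C) (z : C) (hz : IsZero z) :
    ∃ φ : Multiplicative A.K0 ≃*
        FundamentalGroup (QuasiExact.ClassifyingSpace A.QCat)
          (QuasiExact.point (QuasiExact.QuasiExactStructure.QCat.of z : A.QCat)),
      ∀ X : C, φ (Multiplicative.ofAdd (A.k0Class X)) =
        FundamentalGroup.fromPath (Path.Homotopic.Quotient.mk (A.canonicalLoop hz X)) := by
  obtain ⟨φ, hφ⟩ := A.exists_hom_fundamentalGroup hz
  obtain ⟨ψ, hψ⟩ := A.exists_fundamentalGroup_hom hz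
  have hinj : ψ.comp φ = MonoidHom.id _ :=
      QuasiExact.QuasiExactStructure.k0_hom_ext fun X => by
    rw [MonoidHom.comp_apply, hφ, hψ, MonoidHom.id_apply]
  have hsurj : φ.range = ⊤ := by
    rw [eq_top_iff, ← A.closure_range_loop hz, Subgroup.closure_le]
    rintro _ ⟨X, rfl⟩
    exact ⟨_, hφ X⟩
  exact ⟨MulEquiv.ofBijective φ ⟨fun a b h => by
    have h' : (ψ.comp φ) a = (ψ.comp φ) b := congrArg ψ h
    rwa [hinj] at h',
    MonoidHom.range_eq_top.1 hsurj⟩, fun X => hφ X⟩
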